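/- Let $\Lambda=\mathbb Z\times\mathbb Z\times\frac1{\sqrt2}\mathbb Z\subset\mathbb R^3$, $$\tau=\begin{pmatrix}0&-1&0\\-1&0&0\\0&0&-1\end{pmatrix},\qquad \rho=\begin{pmatrix}-1&0&0\\0&-1&0\\0&0&1\end{pmatrix},\qquad A=\begin{pmatrix}-\frac12&-\frac12&\frac1{\sqrt2}\\ \frac12&\frac12&\frac1{\sqrt2}\\ \frac1{\sqrt2}&-\frac1{\sqrt2}&0\end{pmatrix},$$ and write $L_b$ for the translation $x\mapsto x+b$ of $\mathbb R^3$. Let $\Gamma_1$ (resp. $\Gamma_2$) be the group of isometries of $\mathbb R^3$ generated by $L_\Lambda=\{L_\lambda\mid\lambda\in\Lambda\}$ and $\tau$ (resp. $\rho$), and let $\mathcal O_i=\Gamma_i\backslash\mathbb R^3$. The isotropy group of the image of $x$ in $\mathcal O_i$ is the stabilizer of $x$ in $\Gamma_i$, and the singular set consists of the points with nontrivial isotropy group. Smooth $k$-forms on $\mathcal O_i$ are the $\Gamma_i$-invariant smooth $k$-forms on $\mathbb R^3$, with Laplace operator $dd^*+d^*d$. Let $\Lambda'=\operatorname{span}_{\mathbb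 Z}\{(1,1,0),(1,-1,0),(0,0,\sqrt2)\}$ and let $T=\mathbb R^3/\Lambda'$ be the associated flat torus. For an isometry $\gamma$ of $\mathbb R^3$ which descends to $T$ let $\overline\gamma$ be the induced isometry of $T$. Then: 1. $\Gamma_1=\{\tau^jL_\lambda\mid j\in\{0,1\},\lambda\in\Lambda\}$ and $\Gamma_2=\{\rho^jL_\lambda\mid j\in\{0,1\},\lambda\in\Lambda\}$; both act properly discontinuously with compact quotient on $\mathbb R^3$, so that $\mathcal O_1,\mathcal O_2$ are compact flat orbifolds. 2. Every nontrivial isotropy group of $\mathcal O_1$ and of $\mathcal O_2$ is isomorphic to $\mathbb Z_2$. The points of $\mathbb R^3$ with nontrivial stabilizer in $\Gamma_1$ are those with $x_3\in\frac1{2\sqrt2}\mathbb Z$ and $x_1+x_2\in\mathbb Z$; those with nontrivial stabilizer in $\Gamma_2$ are the ones with $x_1,x_2\in\frac12\mathbb Z$. The singular set of $\mathcal O_1$ is a disjoint union of two circles of length $\sqrt2$, the singular set of $\mathcal O_2$ is a disjoint union of four circles of length $\frac1{\sqrt2}$, and the two singular sets are not homeomorphic. 3. $\Lambda'$ is a sublattice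 of index four of $\Lambda$ and $T$ is compact. Let $G_1=\{\overline{\tau^jL_\lambda}\mid j\in\{0,1\},\lambda\in\Lambda\}$ and $G_2=\{\overline{\rho^jL_\lambda}\mid j\in\{0,1\},\lambda\in\Lambda\}$, let $H\subset O(3)$ be the subgroup generated by $\tau,\rho,A$, and let $G=\{\overline{BL_b}\mid B\in H,\ b\in\mathbb R^3,\ 4b\in\Lambda'\}$. Then $G$ is a finite subgroup of the isometry group of $T$, $G_1$ and $G_2$ are subgroups of $G$ with eight elements each, and $G_1,G_2$ are almost conjugate in $G$: each conjugacy class of $G$ contains equally many elements of $G_1$ and of $G_2$. Moreover $\mathcal O_i$ is isometric, as a Riemannian orbifold, to $G_i\backslash T$ for $i=1,2$. Thus $\mathcal O_1$ and $\mathcal O_2$ are Sunada-isospectral (that is, isometric to quotients of a common compact Riemannian manifold by finite groups which are almost conjugate in a group of isometries). 4. $\mathcal O_1$ and $\mathcal O_2$ are isospectral on $k$-forms for every $k\ge0$: every real number is an eigenvalue of the Laplace operators on smooth $k$-forms of $\mathcal O_1$ and of $\mathcal O_2$ with the same, finite multiplicity (possibly zero). -/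

import Mathlib

open scoped ContDiff Topology Matrix

noncomputable section

namespace FlatOrbifold

/-! ### Good orbifolds: quotients of a space by a group of isometries -/

section Good

variable {X Y : Type*} [PseudoMetricSpace X] [PseudoMetricSpace Y]

/-- The full isometry group of `X` (with composition as multiplication) acts on `X`. -/
instance isometryAction : MulAction (X ≃ᵢ X) X where
  smul γ x := γ x
  one_smul _ := rfl
  mul_smul _ _ _ := rfl

theorem smul_eq_apply (γ : X ≃ᵢ X) (x : X) : γ • x = γ x := rfl

/-- The underlying space `Γ \ X` of the orbifold, with the quotient topology. -/
abbrev OrbitSpace (Γ : Subgroup (X ≃ᵢ X)) : Type _ := MulAction.orbitRel.Quotient Γ X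

/-- The canonical projection `X → Γ \ X`. -/
def proj (Γ : Subgroup (X ≃ᵢ X)) (x : X) : OrbitSpace Γ :=
  Quotient.mk (MulAction.orbitRel Γ X) x

/-- The isotropy group at (the image of) `x`: the stabilizer of `x` in `Γ`. -/
abbrev isotropy (Γ : Subgroup (X ≃ᵢ X)) (x : X) : Subgroup Γ := MulAction.stabilizer Γ x

/-- The singular set: the points of `Γ \ X` with nontrivial isotropy group. -/
def singularSet (Γ : Subgroup (X ≃ᵢ X)) : Set (OrbitSpace Γ) :=
  {p | ∃ x : X, proj Γ x = p ∧ isotropy Γ x ≠ ⊥}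

/-- The quotient distance on `Γ \ X`: the distance between two orbits. -/
def orbitDist (Γ : Subgroup (X ≃ᵢ X)) (p q : OrbitSpace Γ) : ℝ :=
  sInf {d : ℝ | ∃ x y : X, proj Γ x = p ∧ proj Γ y = q ∧ d = dist x y}

/-- The subset `S` of `Γ \ X` is a disjoint union of `m` circles of length `ℓ`: it is homeomorphic
to the topological sum of `m` copies of `ℝ / ℓℤ`, by a map that is locally distance preserving on
each copy. -/
def IsDisjointUnionOfCircles (Γ : Subgroup (X ≃ᵢ X)) (S : Set (OrbitSpace Γ)) (m : ℕ) (ℓ : ℝ) :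
    Prop :=
  ∃ h : Fin m × AddCircle ℓ ≃ₜ S, ∀ (i : Fin m) (t : AddCircle ℓ), ∃ U ∈ 𝓝 t,
    ∀ s ∈ U, ∀ s' ∈ U, orbitDist Γ (h (i, s)) (h (i, s')) = dist s s'

/-- The orbifolds `Γ \ X` and `Γ' \ Y` are isometric: there is a homeomorphism of the underlying
spaces which near every point lifts to an isometry between metric balls in `X` and `Y`. -/
def OrbifoldIsometric (Γ : Subgroup (X ≃ᵢ X)) (Γ' : Subgroup (Y ≃ᵢ Y)) : Prop :=
  ∃ f : OrbitSpace Γ ≃ₜ OrbitSpace Γ', ∀ x : X, ∃ y : Y, f (proj Γ x) = proj Γ' y ∧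
    ∃ r > 0, ∃ φ : Metric.ball x r ≃ᵢ Metric.ball y r,
      (∀ z : Metric.ball x r, (z : X) = x → (φ z : Y) = y) ∧
      ∀ z : Metric.ball x r, f (proj Γ (z : X)) = proj Γ' (φ z : Y)

end Good

/-- Two finite subgroups of `G` are almost conjugate in `G` if every conjugacy class of `G` meets
them in the same number of elements. -/
def AlmostConjugate {G : Type*} [Group G] (K₁ K₂ : Subgroup G) : Prop :=
  Finite K₁ ∧ Finite K₂ ∧
    ∀ b : G, (conjugatesOf b ∩ (K₁ : Set G)).ncard = (conjugatesOf b ∩ (K₂ : Set G)).ncard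

/-! ### Differential forms and the Laplace operator on flat orbifolds `Γ \ ℝⁿ` -/

section Forms

variable {n : ℕ}

/-- (Not necessarily smooth) differential `k`-forms on `ℝⁿ`. -/
abbrev Form (n k : ℕ) : Type :=
  EuclideanSpace ℝ (Fin n) → EuclideanSpace ℝ (Fin n) [⋀^Fin k]→L[ℝ] ℝ

/-- The codifferential `d* θ = - ∑ᵢ ι(eᵢ) ∂ᵢθ` on Euclidean space. -/
def codiff {k : ℕ} (θ : Form n (k + 1)) : Form n k := fun x =>
  -∑ i : Fin n, (fderiv ℝ θ x (EuclideanSpace.single i 1)).curryLeft (EuclideanSpace.single i 1)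

/-- The Laplace operator `d d* + d* d` on `k`-forms on `ℝⁿ`; on functions it is `d* d`. -/
def formLaplacian : {k : ℕ} → Form n k → Form n k
  | 0, θ => codiff (extDeriv θ)
  | _ + 1, θ => extDeriv (codiff θ) + codiff (extDeriv θ)

/-- The pullback `γ^* θ`. -/
def pullback {k : ℕ} (γ : EuclideanSpace ℝ (Fin n) ≃ᵢ EuclideanSpace ℝ (Fin n)) (θ : Form n k) :
    Form n k := fun x => (θ (γ x)).compContinuousLinearMap (fderiv ℝ γ x)

theorem contDiff_extDeriv {k : ℕ} {θ : Form n k} (h : ContDiff ℝ ∞ θ) :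
    ContDiff ℝ ∞ (extDeriv θ) :=
  (ContinuousAlternatingMap.alternatizeUncurryFinCLM ℝ (EuclideanSpace ℝ (Fin n)) ℝ).contDiff.comp
    (h.fderiv_right (by simp))

theorem contDiff_codiff {k : ℕ} {θ : Form n (k + 1)} (h : ContDiff ℝ ∞ θ) :
    ContDiff ℝ ∞ (codiff θ) := by
  refine ContDiff.neg (ContDiff.sum fun i _ => ?_)
  have h1 : ContDiff ℝ ∞ fun x => fderiv ℝ θ x (EuclideanSpace.single i 1) :=
    (h.fderiv_right (by simp)).clm_apply contDiff_const
  have h0 : ContDiff ℝ ∞ fun f : EuclideanSpace ℝ (Fin n) [⋀^Fin (k + 1)]→L[ℝ] ℝ =>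
      f.curryLeft :=
    LinearIsometry.contDiff (𝕜 := ℝ) (E := EuclideanSpace ℝ (Fin n) [⋀^Fin (k + 1)]→L[ℝ] ℝ)
      (F := EuclideanSpace ℝ (Fin n) →L[ℝ] EuclideanSpace ℝ (Fin n) [⋀^Fin k]→L[ℝ] ℝ)
      ContinuousAlternatingMap.curryLeftLI
  have h2 : ContDiff ℝ ∞ fun x => (fderiv ℝ θ x (EuclideanSpace.single i 1)).curryLeft :=
    h0.comp h1
  exact h2.clm_apply contDiff_const

theorem extDeriv_add_smul {k : ℕ} {θ η : Form n k} (hθ : ContDiff ℝ ∞ θ) (hη : ContDiff ℝ ∞ η)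
    (a : ℝ) : extDeriv (a • θ + η) = a • extDeriv θ + extDeriv η := by
  funext x
  have h1 : DifferentiableAt ℝ (a • θ) x := (hθ.const_smul a).differentiable (by simp) x
  rw [extDeriv_add h1 (hη.differentiable (by simp) x), extDeriv_smul]
  rfl

theorem codiff_add_smul {k : ℕ} {θ η : Form n (k + 1)} (hθ : ContDiff ℝ ∞ θ)
    (hη : ContDiff ℝ ∞ η) (a : ℝ) : codiff (a • θ + η) = a • codiff θ + codiff η := by
  funext x
  have h0 : DifferentiableAt ℝ θ x := hθ.differentiable (by simp) x
  have h1 : DifferentiableAt ℝ (a • θ) x := (hθ.const_smul a).differentiable (by simp) x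
  have h2 : DifferentiableAt ℝ η x := hη.differentiable (by simp) x
  ext v
  simp [codiff, fderiv_add h1 h2, fderiv_const_smul h0, Finset.sum_add_distrib, Finset.mul_sum]
  ring

theorem formLaplacian_add_smul {k : ℕ} {θ η : Form n k} (hθ : ContDiff ℝ ∞ θ)
    (hη : ContDiff ℝ ∞ η) (a : ℝ) :
    formLaplacian (a • θ + η) = a • formLaplacian θ + formLaplacian η := by
  cases k with
  | zero =>
    simp only [formLaplacian]
    rw [extDeriv_add_smul hθ hη, codiff_add_smul (contDiff_extDeriv hθ) (contDiff_extDeriv hη)]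
  | succ k =>
    simp only [formLaplacian]
    rw [extDeriv_add_smul hθ hη, codiff_add_smul (contDiff_extDeriv hθ) (contDiff_extDeriv hη),
      codiff_add_smul hθ hη, extDeriv_add_smul (contDiff_codiff hθ) (contDiff_codiff hη)]
    module

theorem pullback_add_smul {k : ℕ} (γ : EuclideanSpace ℝ (Fin n) ≃ᵢ EuclideanSpace ℝ (Fin n))
    (θ η : Form n k) (a : ℝ) : pullback γ (a • θ + η) = a • pullback γ θ + pullback γ η := rfl

/-- The smooth `k`-forms on `Γ \ ℝⁿ` (that is, the `Γ`-invariant smooth `k`-forms on `ℝⁿ`) which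
are eigenforms of the Laplace operator with eigenvalue `c`, together with `0`. -/
def eigenforms (Γ : Subgroup (EuclideanSpace ℝ (Fin n) ≃ᵢ EuclideanSpace ℝ (Fin n))) (k : ℕ)
    (c : ℝ) : Submodule ℝ (Form n k) where
  carrier := {θ | ContDiff ℝ ∞ θ ∧ (∀ γ ∈ Γ, pullback γ θ = θ) ∧ formLaplacian θ = c • θ}
  zero_mem' := by
    refine ⟨contDiff_const, fun γ _ => rfl, ?_⟩
    have h := formLaplacian_add_smul (n := n) (k := k) (θ := 0) (η := 0) contDiff_const
      contDiff_const 1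
    simpa using h
  add_mem' := by
    rintro θ η ⟨h1, h2, h3⟩ ⟨h4, h5, h6⟩
    refine ⟨h1.add h4, fun γ hγ => ?_, ?_⟩
    · have h := pullback_add_smul γ θ η 1
      rw [one_smul, one_smul, h2 γ hγ, h5 γ hγ] at h
      exact h
    · have h := formLaplacian_add_smul h1 h4 1
      rw [one_smul, one_smul, h3, h6] at h
      rw [h, smul_add]
  smul_mem' := by
    rintro a θ ⟨h1, h2, h3⟩
    have h0 : formLaplacian (0 : Form n k) = 0 := by
      have h := formLaplacian_add_smul (n := n) (k := k) (θ := 0) (η := 0) contDiff_const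
        contDiff_const 1
      simpa using h
    refine ⟨h1.const_smul a, fun γ hγ => ?_, ?_⟩
    · have h := pullback_add_smul γ θ 0 a
      rw [h2 γ hγ] at h
      rw [add_zero] at h
      rw [h]
      exact add_zero _
    · have h := formLaplacian_add_smul (η := 0) h1 contDiff_const a
      rw [add_zero, h0, add_zero, h3] at h
      rw [h, smul_comm]

/-- `Γ \ ℝⁿ` and `Γ' \ ℝⁿ` are isospectral on `k`-forms: every real number is an eigenvalue of
the two Laplace operators on `k`-forms with the same, finite multiplicity (possibly `0`). -/
def IsospectralOnForms (Γ Γ' : Subgroup (EuclideanSpace ℝ (Fin n) ≃ᵢ EuclideanSpace ℝ (Fin n)))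
    (k : ℕ) : Prop :=
  ∀ c : ℝ, FiniteDimensional ℝ (eigenforms Γ k c) ∧ FiniteDimensional ℝ (eigenforms Γ' k c) ∧
    Module.finrank ℝ (eigenforms Γ k c) = Module.finrank ℝ (eigenforms Γ' k c)

end Forms

/-! ### Isometries of `ℝⁿ` and of flat tori -/

section Isometries

variable {n : ℕ}

/-- The translation `L_b : x ↦ x + b`. -/
def L (b : EuclideanSpace ℝ (Fin n)) : EuclideanSpace ℝ (Fin n) ≃ᵢ EuclideanSpace ℝ (Fin n) :=
  IsometryEquiv.addRight b

/-- The group `L_Λ` of translations by vectors in `Λ`. -/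
def translations (Λ : AddSubgroup (EuclideanSpace ℝ (Fin n))) :
    Subgroup (EuclideanSpace ℝ (Fin n) ≃ᵢ EuclideanSpace ℝ (Fin n)) where
  carrier := {γ | ∃ b ∈ Λ, γ = L b}
  one_mem' := ⟨0, Λ.zero_mem, by ext x; simp [L]⟩
  mul_mem' := by
    rintro _ _ ⟨b, hb, rfl⟩ ⟨c, hc, rfl⟩
    exact ⟨c + b, Λ.add_mem hc hb, by ext x; simp [L, add_assoc]⟩
  inv_mem' := by
    rintro _ ⟨b, hb, rfl⟩
    refine ⟨-b, Λ.neg_mem hb, ?_⟩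
    rw [inv_eq_iff_mul_eq_one]
    ext x
    simp [L]

theorem norm_mulVec {M : Matrix (Fin n) (Fin n) ℝ} (h : Mᵀ * M = 1) (v : Fin n → ℝ) :
    ‖WithLp.toLp 2 (M *ᵥ v)‖ = ‖WithLp.toLp 2 v‖ := by
  have key : ∀ w : Fin n → ℝ, ∑ i, ‖w i‖ ^ 2 = w ⬝ᵥ w := fun w => by
    simp [dotProduct, sq]
  rw [EuclideanSpace.norm_eq, EuclideanSpace.norm_eq]
  congr 1
  change ∑ i, ‖(M *ᵥ v) i‖ ^ 2 = ∑ i, ‖v i‖ ^ 2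
  rw [key, key, Matrix.dotProduct_mulVec, ← Matrix.mulVec_transpose, Matrix.mulVec_mulVec, h,
    Matrix.one_mulVec]

/-- The isometry `x ↦ M x` of `ℝⁿ` given by an orthogonal matrix `M`. -/
def linearIsometry (M : Matrix (Fin n) (Fin n) ℝ) (h : Mᵀ * M = 1) :
    EuclideanSpace ℝ (Fin n) ≃ᵢ EuclideanSpace ℝ (Fin n) where
  toFun x := WithLp.toLp 2 (M *ᵥ x.ofLp)
  invFun x := WithLp.toLp 2 (Mᵀ *ᵥ x.ofLp)
  left_inv x := by simp [Matrix.mulVec_mulVec, h]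
  right_inv x := by simp [Matrix.mulVec_mulVec, mul_eq_one_comm.mp h]
  isometry_toFun := by
    refine Isometry.of_dist_eq fun x y => ?_
    rw [dist_eq_norm, dist_eq_norm, ← WithLp.toLp_sub, ← Matrix.mulVec_sub, norm_mulVec h]
    rfl

/-- The flat torus `T_Λ = ℝⁿ / Λ` with the quotient metric. -/
abbrev Torus (Λ : AddSubgroup (EuclideanSpace ℝ (Fin n))) : Type := EuclideanSpace ℝ (Fin n) ⧸ Λ

/-- The isometry `f` of `T_Λ` is induced by the isometry `γ` of `ℝⁿ`, that is, `f = γ̄`. -/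
def IsInducedBy (Λ : AddSubgroup (EuclideanSpace ℝ (Fin n))) (f : Torus Λ ≃ᵢ Torus Λ)
    (γ : EuclideanSpace ℝ (Fin n) ≃ᵢ EuclideanSpace ℝ (Fin n)) : Prop :=
  ∀ x : EuclideanSpace ℝ (Fin n), f (QuotientAddGroup.mk x) = QuotientAddGroup.mk (γ x)

/-- The group of isometries of `T_Λ` that are induced by elements of `Γ`. -/
def descend (Λ : AddSubgroup (EuclideanSpace ℝ (Fin n)))
    (Γ : Subgroup (EuclideanSpace ℝ (Fin n) ≃ᵢ EuclideanSpace ℝ (Fin n))) :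
    Subgroup (Torus Λ ≃ᵢ Torus Λ) where
  carrier := {f | ∃ γ ∈ Γ, IsInducedBy Λ f γ}
  one_mem' := ⟨1, Γ.one_mem, fun _ => rfl⟩
  mul_mem' := by
    rintro f g ⟨γ, hγ, hf⟩ ⟨δ, hδ, hg⟩
    refine ⟨γ * δ, Γ.mul_mem hγ hδ, fun x => ?_⟩
    change f (g _) = QuotientAddGroup.mk (γ (δ x))
    rw [hg, hf]
  inv_mem' := by
    rintro f ⟨γ, hγ, hf⟩
    refine ⟨γ⁻¹, Γ.inv_mem hγ, fun x => ?_⟩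
    change f.symm _ = QuotientAddGroup.mk (γ.symm x)
    rw [IsometryEquiv.symm_apply_eq, hf, IsometryEquiv.apply_symm_apply]

end Isometries

/-! ### The two orbifolds -/

/-- Euclidean three-space. -/
abbrev E3 : Type := EuclideanSpace ℝ (Fin 3)

/-- The lattice `ℤ × ℤ × (1/√2)ℤ`. -/
def lattice : AddSubgroup E3 where
  carrier := {x | (∃ a : ℤ, (x 0 : ℝ) = a) ∧ (∃ b : ℤ, (x 1 : ℝ) = b) ∧ ∃ c : ℤ, (x 2 : ℝ) = c / √2}
  zero_mem' := ⟨⟨0, by simp⟩, ⟨0, by simp⟩, ⟨0, by simp⟩⟩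
  add_mem' := by
    rintro x y ⟨⟨a, ha⟩, ⟨b, hb⟩, ⟨c, hc⟩⟩ ⟨⟨a', ha'⟩, ⟨b', hb'⟩, ⟨c', hc'⟩⟩
    exact ⟨⟨a + a', by simp [ha, ha']⟩, ⟨b + b', by simp [hb, hb']⟩,
      ⟨c + c', by simp [hc, hc', add_div]⟩⟩
  neg_mem' := by
    rintro x ⟨⟨a, ha⟩, ⟨b, hb⟩, ⟨c, hc⟩⟩
    exact ⟨⟨-a, by simp [ha]⟩, ⟨-b, by simp [hb]⟩, ⟨-c, by simp [hc, neg_div]⟩⟩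

/-- The lattice spanned by `(1,1,0)`, `(1,-1,0)`, `(0,0,√2)`. -/
def lattice' : AddSubgroup E3 :=
  AddSubgroup.closure {!₂[1, 1, 0], !₂[1, -1, 0], !₂[0, 0, √2]}

/-- The lattice `Λ'/4`, where `Λ'` is `lattice'`. -/
def quarterLattice' : AddSubgroup E3 := lattice'.comap (nsmulAddMonoidHom 4)

def τ : E3 ≃ᵢ E3 :=
  linearIsometry !![0, -1, 0; -1, 0, 0; 0, 0, -1] (by
    ext i j; fin_cases i <;> fin_cases j <;> simp [Matrix.mul_apply, Fin.sum_univ_three])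

def ρ : E3 ≃ᵢ E3 :=
  linearIsometry !![-1, 0, 0; 0, -1, 0; 0, 0, 1] (by
    ext i j; fin_cases i <;> fin_cases j <;> simp [Matrix.mul_apply, Fin.sum_univ_three])

def A : E3 ≃ᵢ E3 :=
  linearIsometry !![-1 / 2, -1 / 2, 1 / √2; 1 / 2, 1 / 2, 1 / √2; 1 / √2, -1 / √2, 0] (by
    have h : (√2 : ℝ)⁻¹ * (√2)⁻¹ = 1 / 2 := by
      rw [← mul_inv, Real.mul_self_sqrt (by norm_num)]; norm_num
    ext i j
    fin_cases i <;> fin_cases j <;>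
      simp [Matrix.mul_apply, Fin.sum_univ_three, neg_div] <;> nlinarith [h])

/-- The group generated by the translations `L_Λ` and `τ`. -/
def Γ₁ : Subgroup (E3 ≃ᵢ E3) := translations lattice ⊔ Subgroup.closure {τ}

/-- The group generated by the translations `L_Λ` and `ρ`. -/
def Γ₂ : Subgroup (E3 ≃ᵢ E3) := translations lattice ⊔ Subgroup.closure {ρ}

/-- The subgroup of `O(3)` generated by `τ`, `ρ` and `A`. -/
def H : Subgroup (E3 ≃ᵢ E3) := Subgroup.closure {τ, ρ, A}

/-- The group of isometries of the torus induced by `Γ₁`. -/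
def G₁ : Subgroup (Torus lattice' ≃ᵢ Torus lattice') := descend lattice' Γ₁

/-- The group of isometries of the torus induced by `Γ₂`. -/
def G₂ : Subgroup (Torus lattice' ≃ᵢ Torus lattice') := descend lattice' Γ₂

/-- The group of isometries of the torus induced by the group generated by `H` and the
translations by vectors in `Λ'/4`. -/
def G : Subgroup (Torus lattice' ≃ᵢ Torus lattice') :=
  descend lattice' (H ⊔ translations quarterLattice')

end FlatOrbifold

end

open FlatOrbifold

namespace FlatOrbifold

/-! ### The Laplace operator on forms acts coefficientwise -/

section FlatLaplacian

variable {n : ℕ}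

/-! The vectors spanning Λ' are pairwise orthogonal of the same length √2. In the coordinates
`frame` which they define, Λ' is ℤ³, the metric is a multiple of the standard one, τ =
diag(-1,1,-1), ρ = diag(-1,-1,1), and A is the signed cyclic permutation (y₀,y₁,y₂) ↦ (y₂,-y₀,y₁),
so that Aτ = ρA. Hence H lies in the finite group `signedPerm`, which preserves ℤ³ and ¼ℤ³.
Everything in sight descends to T, and G is finite. The quotient Λ/Λ' is represented by the vectors
(m/2,m/2,k/2) with m,k ∈ {0,1} (`latticeRep`), which gives index four and eight elements in each Gᵢ.

Almost conjugacy: the translations in G₁ and G₂ coincide. For the other elements, A turns τL_b with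
b = (m/2,m/2,k/2) into ρ followed or preceded by a translation along (k/2,-m/2,m/2), whereas the
element of G₂ with m and k interchanged has (k/2,k/2,m/2). Only the middle coordinate differs; since
ρ reverses it, a further conjugation by the translation along (0,(m+k)/4,0) repairs it modulo Λ'
(`conj_sub_mem`). This is why G contains the translations by Λ'/4, and the conjugating element
depends on (m,k).

Isospectrality is Sunada's argument (`isospectralOnForms_of_equiv`). The eigenforms on 𝒪ᵢ are the
Gᵢ-invariant vectors in an eigenspace of T. Their dimension is the average over Gᵢ of a character of
G, and elementwise conjugate groups have equal averages. This needs finite-dimensional eigenspaces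
on T (`finiteDimensional_eigenforms_translations`): the flat Laplacian acts on coefficients, so by
Green's identity the Fourier coefficients of an eigenform live on the integer points of a sphere,
and they determine the form.

For the singular sets, an element κL_l of Γᵢ fixes x only if l = κx - x, so x has nontrivial
isotropy exactly when κx - x ∈ Λ. The solutions form lines along the axis of κ; modulo Γᵢ they close
up to circles (`isDisjointUnionOfCircles_of_curves`). Two and four circles are told apart by their
numbers of connected components. -/

theorem two_le_infty : (2 : WithTop ℕ∞) ≤ ∞ :=
  WithTop.coe_le_coe.2 (le_top : (2 : ℕ∞) ≤ ⊤)

theorem fderiv_clm_comp_apply {E F F' : Type*} [NormedAddCommGroup E] [NormedSpace ℝ E]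
    [NormedAddCommGroup F] [NormedSpace ℝ F] [NormedAddCommGroup F'] [NormedSpace ℝ F']
    (T : F →L[ℝ] F') {f : E → F} {x : E} (hf : DifferentiableAt ℝ f x) (u : E) :
    fderiv ℝ (fun y => T (f y)) x u = T (fderiv ℝ f x u) :=
  congrArg (fun S => S u) (T.hasFDerivAt.comp x hf.hasFDerivAt).fderiv

theorem hasFDerivAt_clm_comp_apply {E F F' : Type*} [NormedAddCommGroup E] [NormedSpace ℝ E]
    [NormedAddCommGroup F] [NormedSpace ℝ F] [NormedAddCommGroup F'] [NormedSpace ℝ F']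
    (T : F →L[ℝ] F') {f : E → E →L[ℝ] F} {f' : E →L[ℝ] E →L[ℝ] F} {x : E}
    (hf : HasFDerivAt f f' x) (e : E) :
    HasFDerivAt (fun y => T (f y e)) (T.comp ((ContinuousLinearMap.apply ℝ F e).comp f')) x :=
  T.hasFDerivAt.comp x ((ContinuousLinearMap.apply ℝ F e).hasFDerivAt.comp x hf)

theorem fderiv_extDeriv_apply {k : ℕ} {θ : Form n k} (h : ContDiff ℝ ∞ θ)
    (x u : EuclideanSpace ℝ (Fin n)) :
    fderiv ℝ (extDeriv θ) x u =
      ContinuousAlternatingMap.alternatizeUncurryFin (fderiv ℝ (fderiv ℝ θ) x u) := by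
  have h1 : DifferentiableAt ℝ (fderiv ℝ θ) x :=
    (h.fderiv_right (m := ∞) (by simp)).differentiable (by simp) x
  exact fderiv_clm_comp_apply (F := EuclideanSpace ℝ (Fin n) →L[ℝ]
    EuclideanSpace ℝ (Fin n) [⋀^Fin k]→L[ℝ] ℝ) (ContinuousAlternatingMap.alternatizeUncurryFinCLM ℝ
    (EuclideanSpace ℝ (Fin n)) ℝ (n := k)) h1 u

theorem fderiv_codiff_apply {k : ℕ} {θ : Form n (k + 1)} (h : ContDiff ℝ ∞ θ)
    (x u : EuclideanSpace ℝ (Fin n)) (v : Fin k → EuclideanSpace ℝ (Fin n)) :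
    fderiv ℝ (codiff θ) x u v = -∑ i : Fin n, fderiv ℝ (fderiv ℝ θ) x u
      (EuclideanSpace.single i 1) (Matrix.vecCons (EuclideanSpace.single i 1) v) := by
  have h1 : HasFDerivAt (fderiv ℝ θ) (fderiv ℝ (fderiv ℝ θ) x) x :=
    ((h.fderiv_right (m := ∞) (by simp)).differentiable (by simp) x).hasFDerivAt
  let c (i : Fin n) : (EuclideanSpace ℝ (Fin n) [⋀^Fin (k + 1)]→L[ℝ] ℝ) →L[ℝ]
      EuclideanSpace ℝ (Fin n) [⋀^Fin k]→L[ℝ] ℝ :=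
    (ContinuousLinearMap.apply ℝ _ (EuclideanSpace.single i (1 : ℝ))).comp
      (ContinuousAlternatingMap.curryLeftLI (𝕜 := ℝ) (E := EuclideanSpace ℝ (Fin n))
        (F := ℝ) (n := k)).toContinuousLinearMap
  have h2 : HasFDerivAt (codiff θ) (-∑ i : Fin n, (c i).comp
      ((ContinuousLinearMap.apply ℝ _ (EuclideanSpace.single i (1 : ℝ))).comp
        (fderiv ℝ (fderiv ℝ θ) x))) x := by
    refine HasFDerivAt.neg (HasFDerivAt.fun_sum fun i _ => ?_)
    exact hasFDerivAt_clm_comp_apply (c i) h1 (EuclideanSpace.single i (1 : ℝ))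
  rw [h2.fderiv]
  simp [c, ContinuousAlternatingMap.curryLeftLI]

/-- Written with `Fin.cons` so that the term j = 0 is the trace of the second derivative, while the
terms j ≥ 1 are those that cancel against d d*. -/
theorem codiff_extDeriv_apply {k : ℕ} {θ : Form n k} (h : ContDiff ℝ ∞ θ)
    (x : EuclideanSpace ℝ (Fin n)) (v : Fin k → EuclideanSpace ℝ (Fin n)) :
    codiff (extDeriv θ) x v = -∑ i : Fin n, ∑ j : Fin (k + 1), (-1) ^ (j : ℕ) *
      fderiv ℝ (fderiv ℝ θ) x (EuclideanSpace.single i 1)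
        ((Fin.cons (EuclideanSpace.single i 1) v : Fin (k + 1) → EuclideanSpace ℝ (Fin n)) j)
        (j.removeNth (Fin.cons (EuclideanSpace.single i 1) v :
          Fin (k + 1) → EuclideanSpace ℝ (Fin n))) := by
  simp only [codiff, ContinuousAlternatingMap.neg_apply, ContinuousAlternatingMap.sum_apply,
    ContinuousAlternatingMap.curryLeft_apply_apply, fderiv_extDeriv_apply h,
    ContinuousAlternatingMap.alternatizeUncurryFin_apply, Matrix.vecCons]
  simp

/-- The Laplace operator on forms on Euclidean space acts coefficientwise. -/
theorem formLaplacian_apply {k : ℕ} {θ : Form n k} (h : ContDiff ℝ ∞ θ)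
    (x : EuclideanSpace ℝ (Fin n)) :
    formLaplacian θ x = -∑ i : Fin n, fderiv ℝ (fderiv ℝ θ) x (EuclideanSpace.single i 1)
      (EuclideanSpace.single i 1) := by
  ext v
  cases k with
  | zero =>
    simp only [formLaplacian]
    rw [codiff_extDeriv_apply h]
    simp only [ContinuousAlternatingMap.neg_apply,
      ContinuousAlternatingMap.sum_apply]
    congr 1
    refine Finset.sum_congr rfl fun i _ => ?_
    rw [Fin.sum_univ_one]
    simp [Subsingleton.elim _ v]
  | succ k =>
    simp only [formLaplacian, Pi.add_apply, ContinuousAlternatingMap.add_apply]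
    rw [codiff_extDeriv_apply h]
    simp only [Fin.sum_univ_succ (n := k + 1), Fin.cons_zero, Fin.cons_succ]
    rw [extDeriv, ContinuousAlternatingMap.alternatizeUncurryFin_apply]
    have hs : IsSymmSndFDerivAt ℝ θ x := (h.contDiffAt).isSymmSndFDerivAt (by simpa using two_le_infty)
    simp only [fderiv_codiff_apply h]
    simp only [ContinuousAlternatingMap.neg_apply, ContinuousAlternatingMap.sum_apply,
      Finset.sum_add_distrib, neg_add, Finset.smul_sum, smul_neg, Finset.sum_neg_distrib]
    rw [Finset.sum_comm]
    -- Symmetry of the second derivative makes each mixed term of d*d the negative of a term of d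
    -- d*; only the trace survives.
    have e : ∀ i : Fin n, ∀ j : Fin (k + 1), (-1) ^ ((j.succ : Fin (k + 2)) : ℕ) *
        (fderiv ℝ (fderiv ℝ θ) x (EuclideanSpace.single i 1) (v j)
          (j.succ.removeNth (Fin.cons (EuclideanSpace.single i 1) v :
            Fin (k + 2) → EuclideanSpace ℝ (Fin n)))) =
        -((-1) ^ (j : ℕ) • fderiv ℝ (fderiv ℝ θ) x (v j) (EuclideanSpace.single i 1)
          (Matrix.vecCons (EuclideanSpace.single i 1) (j.removeNth v))) := by
      intro i j
      rw [hs.eq (v j) (EuclideanSpace.single i 1)]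
      have : (j.succ.removeNth (Fin.cons (EuclideanSpace.single i 1) v :
            Fin (k + 2) → EuclideanSpace ℝ (Fin n))) =
          Matrix.vecCons (EuclideanSpace.single i 1) (j.removeNth v) := by
        funext l
        refine Fin.cases ?_ (fun l => ?_) l <;> simp [Fin.removeNth, Matrix.vecCons]
      rw [this, Fin.val_succ, pow_succ]
      simp
    simp only [e]
    simp

end FlatLaplacian

/-! ### Pullback by isometries commutes with the Laplace operator -/

section Pullback

variable {n : ℕ}

theorem isometry_eq_linear_add (γ : EuclideanSpace ℝ (Fin n) ≃ᵢ EuclideanSpace ℝ (Fin n)) :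
    (γ : EuclideanSpace ℝ (Fin n) → EuclideanSpace ℝ (Fin n)) = fun y =>
      γ.toRealAffineIsometryEquiv.linearIsometryEquiv y + γ 0 := by
  funext y
  simpa using γ.toRealAffineIsometryEquiv.map_vadd 0 y

theorem isometry_hasFDerivAt (γ : EuclideanSpace ℝ (Fin n) ≃ᵢ EuclideanSpace ℝ (Fin n))
    (x : EuclideanSpace ℝ (Fin n)) :
    HasFDerivAt γ (γ.toRealAffineIsometryEquiv.linearIsometryEquiv.toContinuousLinearEquiv :
      EuclideanSpace ℝ (Fin n) →L[ℝ] EuclideanSpace ℝ (Fin n)) x := by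
  conv => arg 1; rw [isometry_eq_linear_add γ]
  exact (ContinuousLinearMap.hasFDerivAt _).add_const _

theorem contDiff_isometry (γ : EuclideanSpace ℝ (Fin n) ≃ᵢ EuclideanSpace ℝ (Fin n)) :
    ContDiff ℝ ∞ γ := by
  rw [isometry_eq_linear_add γ]
  exact (LinearIsometryEquiv.contDiff _).add contDiff_const

/-- The linear part of an isometry of Euclidean space. -/
noncomputable def linearPart (γ : EuclideanSpace ℝ (Fin n) ≃ᵢ EuclideanSpace ℝ (Fin n)) :
    EuclideanSpace ℝ (Fin n) ≃ₗᵢ[ℝ] EuclideanSpace ℝ (Fin n) :=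
  γ.toRealAffineIsometryEquiv.linearIsometryEquiv

/-- Pullback of alternating forms along the linear part of an isometry. -/
noncomputable def linearPullback (k : ℕ)
    (γ : EuclideanSpace ℝ (Fin n) ≃ᵢ EuclideanSpace ℝ (Fin n)) :
    (EuclideanSpace ℝ (Fin n) [⋀^Fin k]→L[ℝ] ℝ) →L[ℝ] EuclideanSpace ℝ (Fin n) [⋀^Fin k]→L[ℝ] ℝ :=
  ContinuousAlternatingMap.compContinuousLinearMapCLM
    ((linearPart γ).toContinuousLinearEquiv : EuclideanSpace ℝ (Fin n) →L[ℝ] _)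

theorem pullback_eq {k : ℕ} (γ : EuclideanSpace ℝ (Fin n) ≃ᵢ EuclideanSpace ℝ (Fin n))
    (θ : Form n k) : pullback γ θ = fun x => linearPullback k γ (θ (γ x)) := by
  funext x
  rw [pullback, (isometry_hasFDerivAt γ x).fderiv]
  rfl

theorem contDiff_pullback {k : ℕ} (γ : EuclideanSpace ℝ (Fin n) ≃ᵢ EuclideanSpace ℝ (Fin n))
    {θ : Form n k} (h : ContDiff ℝ ∞ θ) : ContDiff ℝ ∞ (pullback γ θ) := by
  rw [pullback_eq]
  exact (linearPullback k γ).contDiff.comp (h.comp (contDiff_isometry γ))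

theorem pullback_mul {k : ℕ} (γ δ : EuclideanSpace ℝ (Fin n) ≃ᵢ EuclideanSpace ℝ (Fin n))
    (θ : Form n k) : pullback (γ * δ) θ = pullback δ (pullback γ θ) := by
  funext x
  ext v
  have h : fderiv ℝ (⇑(γ * δ)) x = (fderiv ℝ γ (δ x)).comp (fderiv ℝ δ x) :=
    fderiv_comp x (isometry_hasFDerivAt γ _).differentiableAt
      (isometry_hasFDerivAt δ x).differentiableAt
  simp only [pullback, h]
  rfl

theorem pullback_one {k : ℕ} (θ : Form n k) : pullback 1 θ = θ := by
  funext x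
  ext v
  have h : fderiv ℝ (⇑(1 : EuclideanSpace ℝ (Fin n) ≃ᵢ EuclideanSpace ℝ (Fin n))) x =
    ContinuousLinearMap.id ℝ _ := fderiv_id
  simp only [pullback, h]
  rfl

theorem pullback_L {k : ℕ} (b : EuclideanSpace ℝ (Fin n)) (θ : Form n k) :
    pullback (L b) θ = fun x => θ (x + b) := by
  funext x
  ext v
  have h : fderiv ℝ (⇑(L b)) x = ContinuousLinearMap.id ℝ _ :=
    ((hasFDerivAt_id x).add_const b).fderiv
  simp only [pullback, h]
  rfl

theorem fderiv_clm_comp_comp {E E' F F' : Type*} [NormedAddCommGroup E] [NormedSpace ℝ E]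
    [NormedAddCommGroup E'] [NormedSpace ℝ E']
    [NormedAddCommGroup F] [NormedSpace ℝ F] [NormedAddCommGroup F'] [NormedSpace ℝ F']
    (T : F →L[ℝ] F') {f : E → F} {g : E' → E} {g' : E' →L[ℝ] E} {x : E'} (hg : HasFDerivAt g g' x)
    (hf : DifferentiableAt ℝ f (g x)) :
    fderiv ℝ (fun y => T (f (g y))) x = (T.comp (fderiv ℝ f (g x))).comp g' :=
  ((T.hasFDerivAt.comp _ hf.hasFDerivAt).comp x hg).fderiv

theorem fderiv_comp_clm_comp_comp_apply {E F F' : Type*} [NormedAddCommGroup E] [NormedSpace ℝ E]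
    [NormedAddCommGroup F] [NormedSpace ℝ F] [NormedAddCommGroup F'] [NormedSpace ℝ F']
    (T : F →L[ℝ] F') {f : E → E →L[ℝ] F} {g : E → E} {g' : E →L[ℝ] E} {x : E}
    (hg : HasFDerivAt g g' x) (hf : DifferentiableAt ℝ f (g x)) (u v : E) :
    fderiv ℝ (fun y => (T.comp (f (g y))).comp g') x u v = T (fderiv ℝ f (g x) (g' u) (g' v)) := by
  have h1 := (hf.hasFDerivAt.comp x hg)
  have h2 := ((hasFDerivAt_const T x).clm_comp h1).clm_comp (hasFDerivAt_const g' x)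
  simp only [Function.comp_def] at h2
  rw [h2.fderiv]
  simp

/-- The trace of a bilinear map may be computed in any orthonormal basis. -/
theorem sum_bilin_comp_linearIsometryEquiv {F : Type*} [NormedAddCommGroup F] [NormedSpace ℝ F]
    (B : EuclideanSpace ℝ (Fin n) →L[ℝ] EuclideanSpace ℝ (Fin n) →L[ℝ] F)
    (g : EuclideanSpace ℝ (Fin n) ≃ₗᵢ[ℝ] EuclideanSpace ℝ (Fin n)) :
    ∑ i : Fin n, B (g (EuclideanSpace.single i 1)) (g (EuclideanSpace.single i 1)) =
      ∑ i : Fin n, B (EuclideanSpace.single i 1) (EuclideanSpace.single i 1) := by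
  let B' : EuclideanSpace ℝ (Fin n) →ₗ[ℝ] EuclideanSpace ℝ (Fin n) →ₗ[ℝ] F :=
    LinearMap.mk₂ ℝ (fun u v => B u v) (by simp) (by simp) (by simp) (by simp)
  -- The tensor ∑ eᵢ ⊗ eᵢ does not depend on the orthonormal basis; applying B to its two
  -- expressions gives the two sums.
  have h1 := InnerProductSpace.canonicalCovariantTensor_eq_sum (EuclideanSpace ℝ (Fin n))
    ((EuclideanSpace.basisFun (Fin n) ℝ).map g)
  rw [InnerProductSpace.canonicalCovariantTensor_eq_sum (EuclideanSpace ℝ (Fin n))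
    (EuclideanSpace.basisFun (Fin n) ℝ)] at h1
  simpa [B'] using (congrArg (TensorProduct.lift B') h1).symm

theorem fderiv_fderiv_pullback {k : ℕ}
    (γ : EuclideanSpace ℝ (Fin n) ≃ᵢ EuclideanSpace ℝ (Fin n)) {θ : Form n k}
    (h : ContDiff ℝ ∞ θ) (x u v : EuclideanSpace ℝ (Fin n)) :
    fderiv ℝ (fderiv ℝ (pullback γ θ)) x u v =
      linearPullback k γ (fderiv ℝ (fderiv ℝ θ) (γ x) (linearPart γ u) (linearPart γ v)) := by
  have h1 : ∀ y, fderiv ℝ (pullback γ θ) y = ((linearPullback k γ).comp (fderiv ℝ θ (γ y))).comp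
      ((linearPart γ).toContinuousLinearEquiv : EuclideanSpace ℝ (Fin n) →L[ℝ] _) := fun y => by
    rw [pullback_eq]
    exact fderiv_clm_comp_comp (linearPullback k γ) (isometry_hasFDerivAt γ y)
      (h.differentiable (by simp) _)
  have h2 : DifferentiableAt ℝ (fderiv ℝ θ) (γ x) :=
    (h.fderiv_right (m := ∞) (by simp)).differentiable (by simp) _
  rw [funext h1]
  exact fderiv_comp_clm_comp_comp_apply (linearPullback k γ) (isometry_hasFDerivAt γ x) h2 u v

/-- The linear part of γ is orthogonal, so it preserves the trace of the second derivative, and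
pullback acts on values by a fixed linear map. -/
theorem formLaplacian_pullback {k : ℕ}
    (γ : EuclideanSpace ℝ (Fin n) ≃ᵢ EuclideanSpace ℝ (Fin n)) {θ : Form n k}
    (h : ContDiff ℝ ∞ θ) : formLaplacian (pullback γ θ) = pullback γ (formLaplacian θ) := by
  funext x
  rw [formLaplacian_apply (contDiff_pullback γ h), pullback_eq γ (formLaplacian θ)]
  simp only [formLaplacian_apply h, map_neg, fderiv_fderiv_pullback γ h]
  rw [← map_sum, sum_bilin_comp_linearIsometryEquiv]

theorem pullback_smul {k : ℕ} (γ : EuclideanSpace ℝ (Fin n) ≃ᵢ EuclideanSpace ℝ (Fin n))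
    (a : ℝ) (θ : Form n k) : pullback γ (a • θ) = a • pullback γ θ := rfl

end Pullback

/-! ### Fourier analysis of periodic eigenfunctions -/

section Fourier
open MeasureTheory

variable {m : ℕ}

/-- Functions on `ℝᵐ` that are periodic with respect to `ℤᵐ`. -/
def IsPeriodic (g : (Fin m → ℝ) → ℂ) : Prop :=
  ∀ (l : Fin m → ℤ) (y : Fin m → ℝ), g (y + fun i => (l i : ℝ)) = g y

theorem IsPeriodic.add_single {g : (Fin m → ℝ) → ℂ} (h : IsPeriodic g) (i : Fin m)
    (y : Fin m → ℝ) : g (y + Pi.single i 1) = g y := by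
  rw [← h (Pi.single i 1) y]
  congr 2
  funext j
  by_cases hj : j = i
  · subst hj; simp
  · simp [hj]

theorem IsPeriodic.fderiv_apply {g : (Fin m → ℝ) → ℂ} (h : IsPeriodic g) (u : Fin m → ℝ) :
    IsPeriodic fun y => fderiv ℝ g y u := by
  intro l y
  have h1 : (fun z => g (z + fun i => (l i : ℝ))) = g := funext (h l)
  have h2 := fderiv_comp_add_right (𝕜 := ℝ) (f := g) (x := y) (fun i => (l i : ℝ))
  rw [h1] at h2
  simp only [h2]

/-- The integral of a divergence over a period cube vanishes. -/
theorem integral_divergence_eq_zero {F : Fin (m + 1) → (Fin (m + 1) → ℝ) → ℂ}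
    (hF : ∀ i, ContDiff ℝ 1 (F i)) (hp : ∀ i, IsPeriodic (F i)) :
    ∫ y in Set.Icc (0 : Fin (m + 1) → ℝ) 1, ∑ i, fderiv ℝ (F i) y (Pi.single i 1) = 0 := by
  rw [integral_divergence_of_hasFDerivAt_off_countable' (0 : Fin (m + 1) → ℝ) 1 zero_le_one F
    (fun i => fderiv ℝ (F i)) ∅ Set.countable_empty (fun i => (hF i).continuous.continuousOn)
    (fun x _ i => ((hF i).differentiable (by simp) x).hasFDerivAt)]
  -- The integrals over opposite faces cancel by periodicity.
  · refine Finset.sum_eq_zero fun i _ => ?_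
    rw [sub_eq_zero]
    congr 1
    funext x
    rw [← (hp i).add_single i (i.insertNth ((0 : Fin (m + 1) → ℝ) i) x)]
    congr 1
    funext j
    refine i.succAboveCases ?_ (fun j => ?_) j <;> simp
  · refine Continuous.integrableOn_Icc (continuous_finsetSum _ fun i _ => ?_)
    exact ((hF i).continuous_fderiv (by simp)).clm_apply continuous_const

/-- Green's identity on a period cube. -/
theorem integral_laplacian_mul {g e : (Fin (m + 1) → ℝ) → ℂ} (hg : ContDiff ℝ ∞ g)
    (he : ContDiff ℝ ∞ e) (pg : IsPeriodic g) (pe : IsPeriodic e) :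
    ∫ y in Set.Icc (0 : Fin (m + 1) → ℝ) 1,
      ((∑ i, fderiv ℝ (fun z => fderiv ℝ g z (Pi.single i 1)) y (Pi.single i 1)) * e y -
        g y * ∑ i, fderiv ℝ (fun z => fderiv ℝ e z (Pi.single i 1)) y (Pi.single i 1)) = 0 := by
  have sm : ∀ {f : (Fin (m + 1) → ℝ) → ℂ}, ContDiff ℝ ∞ f → ∀ u,
      ContDiff ℝ ∞ fun z => fderiv ℝ f z u :=
    fun hf u => (hf.fderiv_right (by simp)).clm_apply contDiff_const
  have df : ∀ {f : (Fin (m + 1) → ℝ) → ℂ}, ContDiff ℝ ∞ f → ∀ y, HasFDerivAt f (fderiv ℝ f y) y :=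
    fun hf y => (hf.differentiable (by simp) y).hasFDerivAt
  -- The divergence of e ∇g - g ∇e is e Δg - g Δe.
  let F : Fin (m + 1) → (Fin (m + 1) → ℝ) → ℂ := fun i y =>
    fderiv ℝ g y (Pi.single i 1) * e y - g y * fderiv ℝ e y (Pi.single i 1)
  have h := integral_divergence_eq_zero (F := F)
    (fun i => (((sm hg _).mul he).sub (hg.mul (sm he _))).of_le (by simp))
    (fun i l y => by
      simp only [F, pg l y, pe l y, pg.fderiv_apply (Pi.single i 1) l y,
        pe.fderiv_apply (Pi.single i 1) l y])
  rw [← h]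
  congr 1
  funext y
  rw [Finset.sum_mul, Finset.mul_sum, ← Finset.sum_sub_distrib]
  refine Finset.sum_congr rfl fun i _ => ?_
  have h1 : HasFDerivAt (F i) _ y := ((df (sm hg (Pi.single i 1)) y).mul (df he y)).sub
    ((df hg y).mul (df (sm he (Pi.single i 1)) y))
  rw [h1.fderiv]
  simp
  ring

/-- The linear form `y ↦ 2πi ⟨k, y⟩`. -/
noncomputable def phase (k : Fin m → ℤ) : (Fin m → ℝ) →L[ℝ] ℂ :=
  ∑ i, (ContinuousLinearMap.proj (R := ℝ) (φ := fun _ : Fin m => ℝ) i).smulRight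
    (2 * Real.pi * Complex.I * k i : ℂ)

theorem phase_apply (k : Fin m → ℤ) (y : Fin m → ℝ) :
    phase k y = ∑ i, 2 * Real.pi * Complex.I * k i * y i := by
  simp only [phase, sum_apply]
  refine Finset.sum_congr rfl fun i _ => ?_
  simp
  ring

/-- The exponential `y ↦ exp (2πi ⟨k, y⟩)`. -/
noncomputable def wave (k : Fin m → ℤ) (y : Fin m → ℝ) : ℂ := Complex.exp (phase k y)

theorem wave_eq_mFourier (k : Fin m → ℤ) (y : Fin m → ℝ) :
    wave k y = UnitAddTorus.mFourier k (fun i => (y i : UnitAddCircle)) := by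
  simp [wave, phase_apply, UnitAddTorus.mFourier, Complex.exp_sum]

theorem contDiff_wave (k : Fin m → ℤ) : ContDiff ℝ ∞ (wave k) :=
  (phase k).contDiff.cexp

theorem isPeriodic_wave (k : Fin m → ℤ) : IsPeriodic (wave k) := by
  intro l y
  simp [wave_eq_mFourier]

theorem fderiv_wave_apply (k : Fin m → ℤ) (y u : Fin m → ℝ) :
    fderiv ℝ (wave k) y u = phase k u * wave k y := by
  have h : HasFDerivAt (wave k) _ y := (phase k).hasFDerivAt.cexp
  rw [h.fderiv]
  simp [wave, mul_comm]

theorem laplacian_wave (k : Fin m → ℤ) (y : Fin m → ℝ) :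
    ∑ i, fderiv ℝ (fun z => fderiv ℝ (wave k) z (Pi.single i 1)) y (Pi.single i 1) =
      -(4 * Real.pi ^ 2 * ∑ i, (k i : ℝ) ^ 2 : ℝ) * wave k y := by
  have h : ∀ i, phase k (Pi.single i 1) = 2 * Real.pi * Complex.I * k i := fun i => by
    rw [phase_apply, Finset.sum_eq_single i]
    · simp
    · intro j _ hj; simp [hj]
    · simp
  have h2 : ∀ i, fderiv ℝ (fun z => fderiv ℝ (wave k) z (Pi.single i 1)) y (Pi.single i 1) =
      -(4 * Real.pi ^ 2 * (k i : ℂ) ^ 2) * wave k y := fun i => by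
    simp only [fderiv_wave_apply]
    rw [fderiv_const_mul ((contDiff_wave k).differentiable (by simp) y)]
    simp only [smul_apply, fderiv_wave_apply, h, smul_eq_mul]
    linear_combination (4 * Real.pi ^ 2 * (k i : ℂ) ^ 2 * wave k y) * Complex.I_sq
  simp only [h2, ← Finset.sum_mul]
  congr 1
  push_cast
  rw [Finset.sum_neg_distrib, Finset.mul_sum]

/-- The Fourier coefficients of an eigenfunction vanish away from a sphere. -/
theorem fourierIntegral_eq_zero {g : (Fin (m + 1) → ℝ) → ℂ} (hg : ContDiff ℝ ∞ g)
    (pg : IsPeriodic g) {μ : ℝ}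
    (h : ∀ y, ∑ i, fderiv ℝ (fun z => fderiv ℝ g z (Pi.single i 1)) y (Pi.single i 1) =
      -(μ : ℂ) * g y) {k : Fin (m + 1) → ℤ} (hk : 4 * Real.pi ^ 2 * ∑ i, (k i : ℝ) ^ 2 ≠ μ) :
    ∫ y in Set.Icc (0 : Fin (m + 1) → ℝ) 1, wave k y * g y = 0 := by
  have h1 := integral_laplacian_mul hg (contDiff_wave k) pg (isPeriodic_wave k)
  simp only [h, laplacian_wave] at h1
  have h2 : ∀ y, -(μ : ℂ) * g y * wave k y -
      g y * (-((4 * Real.pi ^ 2 * ∑ i, (k i : ℝ) ^ 2 : ℝ) : ℂ) * wave k y) =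
      ((4 * Real.pi ^ 2 * ∑ i, (k i : ℝ) ^ 2 : ℝ) - μ : ℂ) * (wave k y * g y) := fun y => by ring
  simp only [h2] at h1
  rw [integral_const_mul] at h1
  rcases mul_eq_zero.1 h1 with h3 | h3
  · exact absurd (by exact_mod_cast sub_eq_zero.1 h3) hk
  · exact h3

/-- A continuous periodic function with vanishing Fourier coefficients is zero. -/
theorem eq_zero_of_fourierIntegral {g : (Fin m → ℝ) → ℂ} (hg : Continuous g) (pg : IsPeriodic g)
    -- The function descends to a continuous function on the unit torus with zero Fourier
    -- coefficients; its Fourier series is then summable and converges pointwise to it.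
    (h : ∀ k : Fin m → ℤ, ∫ y in Set.Icc (0 : Fin m → ℝ) 1, wave k y * g y = 0) : g = 0 := by
  let q : (Fin m → ℝ) → UnitAddTorus (Fin m) := fun y i => (y i : UnitAddCircle)
  have hq : IsOpenQuotientMap q :=
    IsOpenQuotientMap.piMap fun _ => QuotientAddGroup.isOpenQuotientMap_mk
  let f : UnitAddTorus (Fin m) → ℂ := fun t => g fun i => Quotient.out (t i)
  have hf : ∀ y, f (q y) = g y := fun y => by
    have h1 : ∀ i, ∃ l : ℤ, (Quotient.out (q y i) : ℝ) = y i + l := fun i => by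
      have h2 : ((Quotient.out (q y i) : ℝ) : UnitAddCircle) = (y i : UnitAddCircle) :=
        Quotient.out_eq' (q y i)
      rw [← sub_eq_zero, ← AddCircle.coe_sub, AddCircle.coe_eq_zero_iff] at h2
      obtain ⟨l, hl⟩ := h2
      exact ⟨l, by rw [add_comm, ← sub_eq_iff_eq_add]; simpa using hl.symm⟩
    choose l hl using h1
    rw [← pg l y]
    exact congrArg g (funext hl)
  have hc : Continuous f := hq.isQuotientMap.continuous_iff.2 (by
    rw [show f ∘ q = g from funext hf]; exact hg)
  have h0 : ∀ k, UnitAddTorus.mFourierCoeff f k = 0 := fun k => by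
    rw [UnitAddTorus.mFourierCoeff_eq_integral f k 0, ← h (-k)]
    have hs : {x : Fin m → ℝ | ∀ i, x i ∈ Set.Ioc ((0 : Fin m → ℝ) i) ((0 : Fin m → ℝ) i + 1)} =
        Set.univ.pi fun i => Set.Ioc ((0 : Fin m → ℝ) i) ((1 : Fin m → ℝ) i) := by
      ext x; simp
    rw [hs, volume_pi, setIntegral_congr_set Measure.univ_pi_Ioc_ae_eq_Icc]
    simp only [wave_eq_mFourier, smul_eq_mul]
    congr 1
    funext y
    exact congrArg _ (hf y)
  have h2 := UnitAddTorus.hasSum_mFourier_series_apply_of_summable (f := ⟨f, hc⟩)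
    (by simp [funext h0])
  funext y
  have h3 := h2 (q y)
  simp only [ContinuousMap.coe_mk, h0, zero_smul, hf] at h3
  exact (hasSum_zero.unique h3).symm

/-- Since 4π² ≥ 1 each kᵢ² is at most ⌈μ⌉, and ±kᵢ ≤ kᵢ² for integers. -/
theorem finite_setOf_sum_sq_eq (μ : ℝ) :
    {k : Fin m → ℤ | 4 * Real.pi ^ 2 * ∑ i, (k i : ℝ) ^ 2 = μ}.Finite := by
  refine (Set.Finite.pi' fun _ : Fin m => Set.finite_Icc (-⌈μ⌉) ⌈μ⌉).subset fun k hk i => ?_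
  rw [Set.mem_ofPred_eq] at hk
  have h1 : (k i : ℝ) ^ 2 ≤ ∑ i, (k i : ℝ) ^ 2 :=
    Finset.single_le_sum (f := fun i => (k i : ℝ) ^ 2) (fun _ _ => sq_nonneg _) (Finset.mem_univ i)
  have h2 : (1 : ℝ) ≤ 4 * Real.pi ^ 2 := by nlinarith [Real.pi_gt_three]
  have h3 : (k i : ℝ) ^ 2 ≤ ⌈μ⌉ := by
    refine le_trans ?_ (Int.le_ceil μ)
    nlinarith [sq_nonneg (k i : ℝ)]
  have h4 : k i ^ 2 ≤ ⌈μ⌉ := by exact_mod_cast h3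
  have h5 := Int.le_self_sq (k i)
  have h6 := Int.le_self_sq (-k i)
  rw [neg_sq] at h6
  exact ⟨by linarith, by linarith⟩

end Fourier

/-! ### Coordinates in which Λ' is ℤ³ -/

section Frame

/-- The coordinates on `ℝ³` with respect to the basis `(1,1,0)`, `(1,-1,0)`, `(0,0,√2)` of
`lattice'`. -/
noncomputable def frame : (Fin 3 → ℝ) ≃L[ℝ] E3 :=
  LinearEquiv.toContinuousLinearEquiv
    { toFun := fun y => !₂[y 0 + y 1, y 0 - y 1, √2 * y 2]
      map_add' := fun y z => by ext i; fin_cases i <;> simp <;> ring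
      map_smul' := fun a y => by ext i; fin_cases i <;> simp <;> ring
      invFun := fun x => ![(x 0 + x 1) / 2, (x 0 - x 1) / 2, x 2 / √2]
      left_inv := fun y => by
        have h : (√2 : ℝ) ≠ 0 := by positivity
        ext i; fin_cases i <;> simp [h]
      right_inv := fun x => by
        have h : (√2 : ℝ) ≠ 0 := by positivity
        ext i; fin_cases i <;> simp <;> field_simp <;> ring }

theorem frame_apply (y : Fin 3 → ℝ) : frame y = !₂[y 0 + y 1, y 0 - y 1, √2 * y 2] := rfl

@[simp] theorem frame_zero (y : Fin 3 → ℝ) : frame y 0 = y 0 + y 1 := rfl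
@[simp] theorem frame_one (y : Fin 3 → ℝ) : frame y 1 = y 0 - y 1 := rfl
@[simp] theorem frame_two (y : Fin 3 → ℝ) : frame y 2 = √2 * y 2 := rfl

theorem norm_frame_sq (y : Fin 3 → ℝ) : ‖frame y‖ ^ 2 = 2 * ∑ i, y i ^ 2 := by
  have h : (√2 : ℝ) ^ 2 = 2 := Real.sq_sqrt (by norm_num)
  rw [EuclideanSpace.norm_sq_eq]
  simp [Fin.sum_univ_three, mul_pow, h]
  ring

theorem abs_le_norm_frame (y : Fin 3 → ℝ) (i : Fin 3) : |y i| ≤ ‖frame y‖ := by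
  refine abs_le_of_sq_le_sq ?_ (norm_nonneg _)
  rw [norm_frame_sq]
  have : y i ^ 2 ≤ ∑ i, y i ^ 2 :=
    Finset.single_le_sum (f := fun i => y i ^ 2) (fun _ _ => sq_nonneg _) (Finset.mem_univ i)
  nlinarith [sq_nonneg (y i)]

theorem frame_mem_lattice' {y : Fin 3 → ℝ} :
    frame y ∈ lattice' ↔ ∀ i, ∃ l : ℤ, y i = l := by
  constructor
  · intro h
    have key : ∀ x ∈ lattice', ∀ i, ∃ l : ℤ, frame.symm x i = l := by
      intro x hx
      refine AddSubgroup.closure_induction (p := fun x _ => ∀ i, ∃ l : ℤ, frame.symm x i = l)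
        ?_ ?_ ?_ ?_ hx
      -- The three generators of `lattice'` are the images of the standard basis vectors.
      · have e : ∀ j : Fin 3, ∀ i, ∃ l : ℤ, frame.symm (frame (Pi.single j 1)) i = l := by
          intro j i
          rw [ContinuousLinearEquiv.symm_apply_apply]
          exact ⟨(Pi.single j 1 : Fin 3 → ℤ) i, by
            by_cases hj : i = j
            · subst hj; simp
            · simp [hj]⟩
        rintro x (rfl | rfl | rfl)
        · convert e 0 using 5; ext i; fin_cases i <;> simp [frame_apply]
        · convert e 1 using 5; ext i; fin_cases i <;> simp [frame_apply]
        · convert e 2 using 5; ext i; fin_cases i <;> simp [frame_apply]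
      · exact fun i => ⟨0, by simp⟩
      · intro x y _ _ hx hy i
        obtain ⟨a, ha⟩ := hx i
        obtain ⟨b, hb⟩ := hy i
        exact ⟨a + b, by simp [ha, hb]⟩
      · intro x _ hx i
        obtain ⟨a, ha⟩ := hx i
        exact ⟨-a, by simp [ha]⟩
    simpa using key _ h
  · intro h
    choose l hl using h
    have e : frame y = l 0 • !₂[1, 1, 0] + l 1 • !₂[1, -1, 0] + l 2 • !₂[0, 0, √2] := by
      ext i
      fin_cases i <;> simp [frame_apply, hl] <;> ring
    rw [e]
    have hs : ∀ x ∈ ({!₂[1, 1, 0], !₂[1, -1, 0], !₂[0, 0, √2]} : Set E3), x ∈ lattice' :=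
      fun x hx => AddSubgroup.subset_closure hx
    exact add_mem (add_mem (zsmul_mem (hs _ (by simp)) _) (zsmul_mem (hs _ (by simp)) _))
      (zsmul_mem (hs _ (by simp)) _)

theorem frame_mem_quarterLattice' {y : Fin 3 → ℝ} :
    frame y ∈ quarterLattice' ↔ ∀ i, ∃ l : ℤ, 4 * y i = l := by
  change 4 • frame y ∈ lattice' ↔ _
  rw [← map_nsmul, frame_mem_lattice']
  simp

theorem frame_mem_lattice {y : Fin 3 → ℝ} :
    frame y ∈ lattice ↔ (∃ a : ℤ, y 0 + y 1 = a) ∧ (∃ b : ℤ, y 0 - y 1 = b) ∧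
      ∃ c : ℤ, 2 * y 2 = c := by
  have h : (√2 : ℝ) * √2 = 2 := Real.mul_self_sqrt (by norm_num)
  have h0 : (√2 : ℝ) ≠ 0 := by positivity
  change ((∃ a : ℤ, frame y 0 = a) ∧ (∃ b : ℤ, frame y 1 = b) ∧ ∃ c : ℤ, frame y 2 = c / √2) ↔ _
  simp only [frame_zero, frame_one, frame_two, eq_div_iff h0]
  have : √2 * y 2 * √2 = 2 * y 2 := by linear_combination y 2 * h
  rw [this]

theorem lattice'_le_lattice : lattice' ≤ lattice := by
  intro x hx
  obtain ⟨y, rfl⟩ := frame.surjective x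
  rw [frame_mem_lattice'] at hx
  choose l hl using hx
  rw [frame_mem_lattice]
  exact ⟨⟨l 0 + l 1, by simp [hl]⟩, ⟨l 0 - l 1, by simp [hl]⟩, ⟨2 * l 2, by simp [hl]⟩⟩

theorem lattice_le_quarterLattice' : lattice ≤ quarterLattice' := by
  intro x hx
  obtain ⟨y, rfl⟩ := frame.surjective x
  rw [frame_mem_lattice] at hx
  obtain ⟨⟨a, ha⟩, ⟨b, hb⟩, ⟨c, hc⟩⟩ := hx
  rw [frame_mem_quarterLattice']
  intro i
  fin_cases i
  · exact ⟨2 * a + 2 * b, by push_cast; rw [← ha, ← hb]; ring⟩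
  · exact ⟨2 * a - 2 * b, by push_cast; rw [← ha, ← hb]; ring⟩
  · exact ⟨2 * c, by push_cast; rw [← hc]; ring⟩

/-- The Laplace operator in the coordinates `frame`. -/
theorem sum_bilin_frame {F : Type*} [NormedAddCommGroup F] [NormedSpace ℝ F]
    (B : E3 →L[ℝ] E3 →L[ℝ] F) :
    ∑ i, B (frame (Pi.single i 1)) (frame (Pi.single i 1)) =
      (2 : ℝ) • ∑ i, B (EuclideanSpace.single i 1) (EuclideanSpace.single i 1) := by
  have h0 : frame (Pi.single 0 1) = EuclideanSpace.single 0 1 + EuclideanSpace.single 1 1 := by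
    ext i; fin_cases i <;> simp [frame_apply]
  have h1 : frame (Pi.single 1 1) = EuclideanSpace.single 0 1 - EuclideanSpace.single 1 1 := by
    ext i; fin_cases i <;> simp [frame_apply]
  have h2 : frame (Pi.single 2 1) = (√2 : ℝ) • EuclideanSpace.single 2 1 := by
    ext i; fin_cases i <;> simp [frame_apply]
  have h : (√2 : ℝ) * √2 = 2 := Real.mul_self_sqrt (by norm_num)
  simp only [Fin.sum_univ_three, h0, h1, h2, map_add, map_sub, map_smul, add_apply, sub_apply,
    smul_apply, smul_smul, h]
  module

theorem fderiv_fderiv_clm_comp_clm {E E' F F' : Type*} [NormedAddCommGroup E] [NormedSpace ℝ E]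
    [NormedAddCommGroup E'] [NormedSpace ℝ E']
    [NormedAddCommGroup F] [NormedSpace ℝ F] [NormedAddCommGroup F'] [NormedSpace ℝ F']
    (T : F →L[ℝ] F') (S : E' →L[ℝ] E) {f : E → F} (hf : ContDiff ℝ ∞ f) (y u v : E') :
    fderiv ℝ (fun z => fderiv ℝ (fun w => T (f (S w))) z u) y v =
      T (fderiv ℝ (fderiv ℝ f) (S y) (S v) (S u)) := by
  have h1 : ∀ z, fderiv ℝ (fun w => T (f (S w))) z u = T (fderiv ℝ f (S z) (S u)) := fun z => by
    rw [fderiv_clm_comp_comp T S.hasFDerivAt (hf.differentiable (by simp) _)]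
    rfl
  simp only [h1]
  have h2 : DifferentiableAt ℝ (fderiv ℝ f) (S y) :=
    (hf.fderiv_right (m := ∞) (by simp)).differentiable (by simp) _
  have h3 := fderiv_clm_comp_comp (T.comp (ContinuousLinearMap.apply ℝ F (S u))) S.hasFDerivAt h2
  exact congrArg (fun R => R v) h3

end Frame

/-! ### Finite multiplicities on the torus -/

section FiniteDimensional
open MeasureTheory

variable {k : ℕ}

/-- The complex-valued coefficient of a form along the coordinate directions `v`. -/
noncomputable def coefficientCLM (v : Fin k → Fin 3) : (E3 [⋀^Fin k]→L[ℝ] ℝ) →L[ℝ] ℂ :=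
  Complex.ofRealCLM.comp (ContinuousAlternatingMap.apply ℝ E3 ℝ
    (fun i => EuclideanSpace.single (v i) (1 : ℝ)))

theorem eq_zero_of_coefficientCLM {a : E3 [⋀^Fin k]→L[ℝ] ℝ} (h : ∀ v, coefficientCLM v a = 0) :
    a = 0 := by
  refine ContinuousAlternatingMap.toAlternatingMap_injective
    ((EuclideanSpace.basisFun (Fin 3) ℝ).toBasis.ext_alternating fun v _ => ?_)
  have h1 := h v
  simpa [coefficientCLM] using h1

theorem contDiff_coefficient {θ : Form 3 k} (h : ContDiff ℝ ∞ θ) (v : Fin k → Fin 3) :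
    ContDiff ℝ ∞ fun y => coefficientCLM v (θ (frame y)) :=
  (coefficientCLM v).contDiff.comp (h.comp frame.contDiff)

/-- The finitely many Fourier coefficients with frequency on the relevant sphere determine an
eigenform, so the eigenspace embeds into a finite-dimensional space. -/
theorem finiteDimensional_eigenforms_translations (k : ℕ) (c : ℝ) :
    FiniteDimensional ℝ (eigenforms (translations lattice') k c) := by
  -- The factor 2 is the squared length of the frame vectors, by which the Laplacian scales in these
  -- coordinates.
  let S : Set (Fin 3 → ℤ) := {n | 4 * Real.pi ^ 2 * ∑ i, (n i : ℝ) ^ 2 = 2 * c}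
  have : Finite S := finite_setOf_sum_sq_eq _
  have hc : ∀ θ : eigenforms (translations lattice') k c, ∀ (v : Fin k → Fin 3) (n : Fin 3 → ℤ),
      IntegrableOn (fun y => wave n y * coefficientCLM v (θ.1 (frame y))) (Set.Icc 0 1) :=
    fun θ v n => ((contDiff_wave n).continuous.mul
      (contDiff_coefficient θ.2.1 v).continuous).integrableOn_Icc
  let Ψ : eigenforms (translations lattice') k c →ₗ[ℝ] ((Fin k → Fin 3) × S → ℂ) :=
    { toFun := fun θ p => ∫ y in Set.Icc (0 : Fin 3 → ℝ) 1,
        wave p.2.1 y * coefficientCLM p.1 (θ.1 (frame y))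
      map_add' := fun θ η => by
        funext p
        rw [Pi.add_apply, ← integral_add (hc θ _ _) (hc η _ _)]
        simp [mul_add]
      map_smul' := fun a θ => by
        funext p
        rw [Pi.smul_apply, RingHom.id_apply, ← integral_smul]
        congr 1
        funext y
        simp
        ring }
  suffices h : ∀ θ, Ψ θ = 0 → θ = 0 by
    refine FiniteDimensional.of_injective Ψ fun θ₁ θ₂ h12 => sub_eq_zero.1 (h _ ?_)
    exact (LinearMap.map_sub Ψ θ₁ θ₂).trans (sub_eq_zero.2 h12)
  intro θ hθ
  have per : ∀ v, IsPeriodic fun y => coefficientCLM v (θ.1 (frame y)) := by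
    intro v l y
    have h1 := θ.2.2.1 (L (frame fun i => (l i : ℝ)))
      ⟨_, frame_mem_lattice'.2 fun i => ⟨l i, rfl⟩, rfl⟩
    rw [pullback_L] at h1
    simp only [map_add]
    exact congrArg (coefficientCLM v) (congrFun h1 (frame y))
  have h0 : ∀ v, (fun y => coefficientCLM v (θ.1 (frame y))) = 0 := fun v => by
    refine eq_zero_of_fourierIntegral (contDiff_coefficient θ.2.1 v).continuous (per v) fun n => ?_
    by_cases hn : n ∈ S
    · exact congrFun hθ (v, ⟨n, hn⟩)
    · refine fourierIntegral_eq_zero (contDiff_coefficient θ.2.1 v) (per v) (μ := 2 * c) ?_ hn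
      intro y
      have h1 := congrFun θ.2.2.2 (frame y)
      rw [formLaplacian_apply θ.2.1, neg_eq_iff_eq_neg] at h1
      have h2 := fun i : Fin 3 => fderiv_fderiv_clm_comp_clm (coefficientCLM v)
        (frame : (Fin 3 → ℝ) →L[ℝ] E3) θ.2.1 y (Pi.single i 1) (Pi.single i 1)
      simp only [ContinuousLinearEquiv.coe_coe] at h2
      simp only [h2]
      rw [← map_sum, sum_bilin_frame, h1]
      simp
      ring
  refine Subtype.ext (funext fun x => ?_)
  obtain ⟨y, rfl⟩ := frame.surjective x
  exact eq_zero_of_coefficientCLM fun v => congrFun (h0 v) y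

end FiniteDimensional

/-! ### Isometries of the torus and their lifts -/

section TorusIsometries

variable {n : ℕ} {Λ : AddSubgroup (EuclideanSpace ℝ (Fin n))}
  {γ δ : EuclideanSpace ℝ (Fin n) ≃ᵢ EuclideanSpace ℝ (Fin n)}

theorem dist_mk_lt_iff {x y : EuclideanSpace ℝ (Fin n)} {r : ℝ} :
    dist (x : Torus Λ) (y : Torus Λ) < r ↔ ∃ l ∈ Λ, dist x (y + l) < r := by
  rw [dist_eq_norm, ← QuotientAddGroup.mk_sub, QuotientAddGroup.norm_lt_iff]
  constructor
  · rintro ⟨m, hm, h⟩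
    refine ⟨x - y - m, ?_, ?_⟩
    · rw [QuotientAddGroup.eq] at hm
      convert hm using 1
      abel
    · rw [dist_eq_norm]
      convert h using 2
      abel
  · rintro ⟨l, hl, h⟩
    refine ⟨x - y - l, ?_, ?_⟩
    · rw [QuotientAddGroup.eq]
      convert hl using 1
      abel
    · rw [dist_eq_norm] at h
      convert h using 2
      abel

/-- The isometries of `ℝⁿ` whose linear part preserves `Λ`, that is, those that descend to the
torus `ℝⁿ / Λ`. -/
def latticeNormalizer (Λ : AddSubgroup (EuclideanSpace ℝ (Fin n))) :
    Subgroup (EuclideanSpace ℝ (Fin n) ≃ᵢ EuclideanSpace ℝ (Fin n)) where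
  carrier := {γ | ∀ x l, l ∈ Λ ↔ γ (x + l) - γ x ∈ Λ}
  one_mem' := fun x l => by simp
  mul_mem' := by
    intro γ δ hγ hδ x l
    rw [hδ x l, hγ (δ x)]
    simp
  inv_mem' := by
    intro γ hγ x l
    rw [hγ (γ⁻¹ x) (γ⁻¹ (x + l) - γ⁻¹ x)]
    simp

theorem mem_latticeNormalizer :
    γ ∈ latticeNormalizer Λ ↔ ∀ x l, l ∈ Λ ↔ γ (x + l) - γ x ∈ Λ := Iff.rfl

theorem translation_mem_latticeNormalizer (b : EuclideanSpace ℝ (Fin n)) :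
    L b ∈ latticeNormalizer Λ := fun x l => by
  have : L b (x + l) - L b x = l := by change x + l + b - (x + b) = l; abel
  rw [this]

theorem translations_le_latticeNormalizer (Λ' : AddSubgroup (EuclideanSpace ℝ (Fin n))) :
    translations Λ' ≤ latticeNormalizer Λ := by
  rintro _ ⟨b, _, rfl⟩
  exact translation_mem_latticeNormalizer b

theorem mk_apply_eq_mk_apply_iff (hγ : γ ∈ latticeNormalizer Λ)
    {x y : EuclideanSpace ℝ (Fin n)} :
    ((γ x : EuclideanSpace ℝ (Fin n)) : Torus Λ) = (γ y : EuclideanSpace ℝ (Fin n)) ↔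
      (x : Torus Λ) = y := by
  rw [QuotientAddGroup.eq, QuotientAddGroup.eq, hγ x (-x + y)]
  simp [sub_eq_neg_add]

theorem dist_mk_apply_le (hγ : γ ∈ latticeNormalizer Λ) (x y : EuclideanSpace ℝ (Fin n)) :
    dist ((γ x : EuclideanSpace ℝ (Fin n)) : Torus Λ) (γ y : EuclideanSpace ℝ (Fin n)) ≤
      dist (x : Torus Λ) y := by
  refine le_of_forall_gt fun r hr => ?_
  obtain ⟨l, hl, h⟩ := dist_mk_lt_iff.1 hr
  refine dist_mk_lt_iff.2 ⟨γ (y + l) - γ y, (hγ y l).1 hl, ?_⟩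
  rwa [add_sub_cancel, γ.dist_eq]

/-- The isometry of the torus induced by an isometry of `ℝⁿ`. -/
noncomputable def induced (γ : latticeNormalizer Λ) : Torus Λ ≃ᵢ Torus Λ where
  toFun := Quotient.map' γ.1 fun x y h =>
    Quotient.exact' ((mk_apply_eq_mk_apply_iff γ.2).2 (Quotient.sound' h))
  invFun := Quotient.map' γ⁻¹.1 fun x y h =>
    Quotient.exact' ((mk_apply_eq_mk_apply_iff γ⁻¹.2).2 (Quotient.sound' h))
  left_inv := by
    rintro ⟨x⟩
    exact congrArg (QuotientAddGroup.mk (s := Λ)) (γ.1.symm_apply_apply x)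
  right_inv := by
    rintro ⟨x⟩
    exact congrArg (QuotientAddGroup.mk (s := Λ)) (γ.1.apply_symm_apply x)
  isometry_toFun := by
    refine Isometry.of_dist_eq ?_
    rintro ⟨x⟩ ⟨y⟩
    refine le_antisymm (dist_mk_apply_le γ.2 x y) ?_
    -- Neither γ nor its inverse increases torus distances, hence equality.
    have h := dist_mk_apply_le γ⁻¹.2 (γ.1 x) (γ.1 y)
    have e : ∀ z, (γ⁻¹ : latticeNormalizer Λ).1 (γ.1 z) = z := γ.1.symm_apply_apply
    rwa [e, e] at h

theorem isInducedBy_induced (γ : latticeNormalizer Λ) : IsInducedBy Λ (induced γ) γ.1 :=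
  fun _ => rfl

theorem exists_isInducedBy (hγ : γ ∈ latticeNormalizer Λ) : ∃ f, IsInducedBy Λ f γ :=
  ⟨_, isInducedBy_induced ⟨γ, hγ⟩⟩

theorem IsInducedBy.mem_latticeNormalizer {f : Torus Λ ≃ᵢ Torus Λ} (h : IsInducedBy Λ f γ) :
    γ ∈ latticeNormalizer Λ := by
  intro x l
  have h1 : (x : Torus Λ) = ((x + l : EuclideanSpace ℝ (Fin n)) : Torus Λ) ↔ l ∈ Λ := by
    rw [QuotientAddGroup.eq]; simp
  rw [← h1, ← f.injective.eq_iff, h, h, QuotientAddGroup.eq, sub_eq_neg_add]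

theorem IsInducedBy.eq {f g : Torus Λ ≃ᵢ Torus Λ} (hf : IsInducedBy Λ f γ)
    (hg : IsInducedBy Λ g γ) : f = g := by
  ext t
  induction t using QuotientAddGroup.induction_on with
  | H x => rw [hf, hg]

theorem IsInducedBy.mul {f g : Torus Λ ≃ᵢ Torus Λ} (hf : IsInducedBy Λ f γ)
    (hg : IsInducedBy Λ g δ) : IsInducedBy Λ (f * g) (γ * δ) := fun x => by
  change f (g _) = QuotientAddGroup.mk (γ (δ x))
  rw [hg, hf]

theorem IsInducedBy.inv {f : Torus Λ ≃ᵢ Torus Λ} (hf : IsInducedBy Λ f γ) :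
    IsInducedBy Λ f⁻¹ γ⁻¹ := fun x => by
  change f.symm _ = QuotientAddGroup.mk (γ.symm x)
  rw [IsometryEquiv.symm_apply_eq, hf, IsometryEquiv.apply_symm_apply]

/-- A lift of an isometry of the torus is determined up to a lattice translation. -/
theorem IsInducedBy.exists_eq_translation_mul {f : Torus Λ ≃ᵢ Torus Λ}
    (hΛ : ∃ r > 0, ∀ l ∈ Λ, ‖l‖ < r → l = 0)
    (hγ : IsInducedBy Λ f γ) (hδ : IsInducedBy Λ f δ) : ∃ l ∈ Λ, δ = L l * γ := by
  obtain ⟨r, hr, h⟩ := hΛ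
  have hm : ∀ x, δ x - γ x ∈ Λ := fun x => by
    rw [sub_eq_neg_add]
    exact QuotientAddGroup.eq.1 ((hγ x).symm.trans (hδ x))
  have hc : Continuous fun x => δ x - γ x := δ.continuous.sub γ.continuous
  -- The difference of two lifts is continuous with values in the discrete set Λ, so it is constant
  -- on the connected space ℝⁿ.
  have hl : IsLocallyConstant fun x => δ x - γ x := by
    rw [IsLocallyConstant.iff_eventually_eq]
    intro x
    have hev : ∀ᶠ y in 𝓝 x, ‖(δ y - γ y) - (δ x - γ x)‖ < r := by
      have h1 : Continuous fun y => ‖(δ y - γ y) - (δ x - γ x)‖ := (hc.sub continuous_const).norm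
      have h2 := h1.tendsto x
      rw [sub_self, norm_zero] at h2
      exact h2.eventually_lt_const hr
    filter_upwards [hev] with y hy
    exact sub_eq_zero.1 (h _ (sub_mem (hm y) (hm x)) hy)
  refine ⟨δ 0 - γ 0, hm 0, ?_⟩
  ext1 x
  change δ x = γ x + (δ 0 - γ 0)
  rw [hl.apply_eq_of_preconnectedSpace 0 x]
  abel

theorem exists_isInducedBy_of_mem_descend
    {Γ : Subgroup (EuclideanSpace ℝ (Fin n) ≃ᵢ EuclideanSpace ℝ (Fin n))}
    {f : Torus Λ ≃ᵢ Torus Λ} (hf : f ∈ descend Λ Γ) : ∃ γ ∈ Γ, IsInducedBy Λ f γ := hf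

theorem descend_mono {Γ Γ' : Subgroup (EuclideanSpace ℝ (Fin n) ≃ᵢ EuclideanSpace ℝ (Fin n))}
    (h : Γ ≤ Γ') : descend Λ Γ ≤ descend Λ Γ' := by
  rintro f ⟨γ, hγ, hf⟩
  exact ⟨γ, h hγ, hf⟩

end TorusIsometries

/-! ### Quotients of ℝⁿ as quotients of the torus -/

section OrbitSpaces

variable {X : Type*} [PseudoMetricSpace X]

theorem proj_eq_proj_iff {Γ : Subgroup (X ≃ᵢ X)} {x y : X} :
    proj Γ x = proj Γ y ↔ ∃ γ ∈ Γ, γ y = x := by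
  rw [proj, proj, Quotient.eq, MulAction.orbitRel_apply, MulAction.mem_orbit_iff]
  constructor
  · rintro ⟨⟨γ, hγ⟩, h⟩
    exact ⟨γ, hγ, h⟩
  · rintro ⟨γ, hγ, h⟩
    exact ⟨⟨γ, hγ⟩, h⟩

theorem continuous_proj (Γ : Subgroup (X ≃ᵢ X)) : Continuous (proj Γ) :=
  continuous_quotient_mk'

instance continuousConstSMul_isometrySubgroup (Γ : Subgroup (X ≃ᵢ X)) :
    ContinuousConstSMul Γ X := ⟨fun γ => γ.1.continuous⟩

variable {n : ℕ} {Λ : AddSubgroup (EuclideanSpace ℝ (Fin n))}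
  {Γ : Subgroup (EuclideanSpace ℝ (Fin n) ≃ᵢ EuclideanSpace ℝ (Fin n))}

/-- If an induced isometry matches the classes of x and y, its lift matches x and y up to a
translation by Λ, which `h1` puts into Γ; conversely `h2` lets elements of Γ descend. -/
theorem proj_mk_eq_iff (h1 : translations Λ ≤ Γ) (h2 : Γ ≤ latticeNormalizer Λ)
    {x y : EuclideanSpace ℝ (Fin n)} :
    proj (descend Λ Γ) (x : Torus Λ) = proj (descend Λ Γ) (y : Torus Λ) ↔
      proj Γ x = proj Γ y := by
  rw [proj_eq_proj_iff, proj_eq_proj_iff]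
  constructor
  · rintro ⟨f, ⟨γ, hγ, hf⟩, h⟩
    rw [hf, QuotientAddGroup.eq] at h
    refine ⟨L (-γ y + x) * γ, Γ.mul_mem (h1 ⟨_, h, rfl⟩) hγ, ?_⟩
    change γ y + (-γ y + x) = x
    abel
  · rintro ⟨γ, hγ, rfl⟩
    obtain ⟨f, hf⟩ := exists_isInducedBy (h2 hγ)
    exact ⟨f, ⟨γ, hγ, hf⟩, hf y⟩

/-- `Γ \ ℝⁿ` is homeomorphic to the quotient of the torus by the induced group. -/
noncomputable def orbitSpaceHomeomorph (h1 : translations Λ ≤ Γ) (h2 : Γ ≤ latticeNormalizer Λ) :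
    OrbitSpace Γ ≃ₜ OrbitSpace (descend Λ Γ) where
  toFun := Quotient.lift (fun x => proj (descend Λ Γ) (x : Torus Λ)) fun _ _ h =>
    (proj_mk_eq_iff h1 h2).2 (Quotient.sound h)
  invFun := Quotient.lift (Quotient.lift (fun x => proj Γ x) fun x y h =>
      (proj_mk_eq_iff h1 h2).1 (congrArg (proj (descend Λ Γ)) (Quotient.sound h))) (by
    rintro ⟨x⟩ ⟨y⟩ h
    exact (proj_mk_eq_iff h1 h2).1 (Quotient.sound h))
  left_inv := by rintro ⟨x⟩; rfl
  right_inv := by rintro ⟨⟨x⟩⟩; rfl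
  continuous_toFun := Continuous.quotient_lift
    ((continuous_proj _).comp continuous_quotient_mk') _
  continuous_invFun := Continuous.quotient_lift (Continuous.quotient_lift (continuous_proj _) _) _

/-- The quotient by a crystallographic group is isometric, as an orbifold, to the quotient of the
torus by the induced group. -/
theorem orbifoldIsometric_descend (hΛ : ∃ r > 0, ∀ l ∈ Λ, ‖l‖ < r → l = 0)
    (h1 : translations Λ ≤ Γ) (h2 : Γ ≤ latticeNormalizer Λ) :
    OrbifoldIsometric Γ (descend Λ Γ) := by
  obtain ⟨r, hr, hΛ⟩ := hΛ
  -- Points z, w of a ball of radius r/4 are less than r/2 apart. If w + l were closer to z than w,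
  -- then ‖l‖ < r and so l = 0; thus the covering map is isometric on the ball.
  refine ⟨orbitSpaceHomeomorph h1 h2, fun x => ⟨(x : Torus Λ), rfl, r / 4, by positivity, ?_⟩⟩
  have hball : ∀ z : Metric.ball x (r / 4),
      ((z : EuclideanSpace ℝ (Fin n)) : Torus Λ) ∈ Metric.ball (x : Torus Λ) (r / 4) := fun z =>
    dist_mk_lt_iff.2 ⟨0, Λ.zero_mem, by rw [add_zero]; exact z.2⟩
  let φ : Metric.ball x (r / 4) → Metric.ball (x : Torus Λ) (r / 4) :=
    fun z => ⟨((z : EuclideanSpace ℝ (Fin n)) : Torus Λ), hball z⟩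
  have hi : Isometry φ := by
    refine Isometry.of_dist_eq fun z w => ?_
    change dist ((z : EuclideanSpace ℝ (Fin n)) : Torus Λ) ((w : EuclideanSpace ℝ (Fin n)) :
      Torus Λ) = dist (z : EuclideanSpace ℝ (Fin n)) w
    have hzw : dist (z : EuclideanSpace ℝ (Fin n)) w < r / 2 := by
      have := dist_triangle_right (z : EuclideanSpace ℝ (Fin n)) w x
      have h3 := Metric.mem_ball.1 z.2
      have h4 := Metric.mem_ball.1 w.2
      linarith
    refine le_antisymm (le_of_forall_gt fun s hs =>
      dist_mk_lt_iff.2 ⟨0, Λ.zero_mem, by simpa using hs⟩) (not_lt.1 fun hlt => ?_)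
    obtain ⟨l, hl, h⟩ := dist_mk_lt_iff.1 hlt
    have h5 : ‖l‖ < r := by
      have e : l = ((w : EuclideanSpace ℝ (Fin n)) + l - z) + (z - w) := by abel
      have h6 := norm_add_le ((w : EuclideanSpace ℝ (Fin n)) + l - z) (z - w)
      rw [← e, ← dist_eq_norm, ← dist_eq_norm, dist_comm _ (z : EuclideanSpace ℝ (Fin n))] at h6
      linarith
    rw [hΛ l hl h5, add_zero] at h
    exact lt_irrefl _ h
  have hs : Function.Surjective φ := by
    rintro ⟨⟨y⟩, hy⟩
    obtain ⟨l, hl, h⟩ := dist_mk_lt_iff.1 (Metric.mem_ball'.1 hy)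
    refine ⟨⟨y + l, Metric.mem_ball'.2 h⟩, Subtype.ext ?_⟩
    change ((y + l : EuclideanSpace ℝ (Fin n)) : Torus Λ) = (y : Torus Λ)
    rw [QuotientAddGroup.eq]
    simpa using hl
  exact ⟨⟨Equiv.ofBijective φ ⟨hi.injective, hs⟩, hi⟩,
    fun z hz => congrArg (QuotientAddGroup.mk (s := Λ)) hz, fun z => rfl⟩

end OrbitSpaces

/-! ### Almost conjugate groups and dimensions of invariants -/

section AlmostConjugate

variable {G' : Type*} [Group G'] {K₁ K₂ : Subgroup G'}

/-- A bijection that moves each element inside its conjugacy class restricts to a bijection on every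
class. -/
theorem almostConjugate_of_equiv [Finite K₁] (e : K₁ ≃ K₂)
    (he : ∀ x : K₁, IsConj (x : G') (e x)) : AlmostConjugate K₁ K₂ := by
  refine ⟨inferInstance, Finite.of_equiv _ e, fun b => ?_⟩
  refine Set.ncard_congr (fun a ha => (e ⟨a, ha.2⟩ : G')) ?_ ?_ ?_
  · intro a ha
    exact ⟨IsConj.trans (show IsConj b a from ha.1) (he ⟨a, ha.2⟩),
      (e ⟨a, ha.2⟩).2⟩
  · intro a a' ha ha' h
    simpa using h
  · intro a ha
    refine ⟨e.symm ⟨a, ha.2⟩, ⟨?_, (e.symm ⟨a, ha.2⟩).2⟩, by simp⟩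
    have h := he (e.symm ⟨a, ha.2⟩)
    rw [e.apply_symm_apply] at h
    exact IsConj.trans (show IsConj b a from ha.1) h.symm

variable {V : Type*} [AddCommGroup V] [Module ℝ V]

/-- The restriction of a representation to a subgroup. -/
def restrictRep (R : Representation ℝ G' V) (K : Subgroup G') : Representation ℝ K V :=
  MonoidHom.comp R K.subtype

/-- The vectors fixed by a subgroup. -/
noncomputable def fixedVectors (R : Representation ℝ G' V) (K : Subgroup G') : Submodule ℝ V :=
  (restrictRep R K).invariants

/-- The average of the operators R g is a projection onto the invariants, and the trace of a
projection is its rank. -/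
theorem finrank_invariants_eq_sum_trace [FiniteDimensional ℝ V] {K : Type*} [Group K] [Fintype K]
    (R : Representation ℝ K V) : (Module.finrank ℝ R.invariants : ℝ) =
      (Fintype.card K : ℝ)⁻¹ * ∑ g : K, LinearMap.trace ℝ V (R g) := by
  have : Invertible (Fintype.card K : ℝ) :=
    invertibleOfNonzero (Nat.cast_ne_zero.2 Fintype.card_ne_zero)
  rw [← R.isProj_averageMap.trace]
  simp [Representation.averageMap, GroupAlgebra.average, map_sum]

theorem finite_fixedVectors [FiniteDimensional ℝ V] (R : Representation ℝ G' V)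
    (K : Subgroup G') : Module.Finite ℝ (fixedVectors R K) := inferInstance

theorem trace_eq_of_isConj (R : Representation ℝ G' V) {a b : G'} (h : IsConj a b) :
    LinearMap.trace ℝ V (R a) = LinearMap.trace ℝ V (R b) := by
  obtain ⟨c, rfl⟩ := isConj_iff.1 h
  rw [map_mul, LinearMap.trace_mul_comm, ← map_mul]
  simp

/-- Elementwise conjugate finite groups have equally many invariants in any finite-dimensional
representation. -/
theorem finrank_invariants_eq_of_equiv [FiniteDimensional ℝ V] [Finite K₁] (R : Representation ℝ G' V) (e : K₁ ≃ K₂)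
    (he : ∀ x : K₁, IsConj (x : G') (e x)) :
    Module.finrank ℝ (fixedVectors R K₁) = Module.finrank ℝ (fixedVectors R K₂) := by
  have := Fintype.ofFinite K₁
  have : Fintype K₂ := Fintype.ofEquiv _ e
  rw [fixedVectors, fixedVectors, ← Nat.cast_inj (R := ℝ), finrank_invariants_eq_sum_trace, finrank_invariants_eq_sum_trace,
    Fintype.card_congr e, ← e.sum_comp]
  congr 1
  exact Finset.sum_congr rfl fun x _ => trace_eq_of_isConj R (he x)

end AlmostConjugate

/-! ### Sunada's theorem on forms -/

section Sunada

variable {n k : ℕ} {c : ℝ} {Λ : AddSubgroup (EuclideanSpace ℝ (Fin n))}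
  {Γ Γ' : Subgroup (EuclideanSpace ℝ (Fin n) ≃ᵢ EuclideanSpace ℝ (Fin n))}
  {γ δ : EuclideanSpace ℝ (Fin n) ≃ᵢ EuclideanSpace ℝ (Fin n)}

/-- Moving a translation past γ applies the linear part of γ to its vector; that linear part is
expressed as a difference of values so that membership in `latticeNormalizer` applies directly. -/
theorem mul_L_eq (γ : EuclideanSpace ℝ (Fin n) ≃ᵢ EuclideanSpace ℝ (Fin n))
    (l : EuclideanSpace ℝ (Fin n)) : γ * L l = L (γ (0 + l) - γ 0) * γ := by
  ext1 x
  change γ (x + l) = γ x + (γ (0 + l) - γ 0)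
  rw [isometry_eq_linear_add γ]
  simp
  abel

/-- Pullback of eigenforms on the torus along an isometry that descends to the torus. -/
noncomputable def pullbackEigenforms (hγ : γ ∈ latticeNormalizer Λ) :
    eigenforms (translations Λ) k c →ₗ[ℝ] eigenforms (translations Λ) k c where
  toFun θ := ⟨pullback γ θ.1, contDiff_pullback γ θ.2.1, by
    rintro _ ⟨l, hl, rfl⟩
    rw [← pullback_mul, mul_L_eq, pullback_mul, θ.2.2.1 _ ⟨_, (hγ 0 l).1 hl, rfl⟩], by
    rw [formLaplacian_pullback γ θ.2.1, θ.2.2.2, pullback_smul]⟩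
  map_add' θ η := rfl
  map_smul' a θ := rfl

theorem pullback_eq_of_isInducedBy {f : Torus Λ ≃ᵢ Torus Λ}
    (hΛ : ∃ r > 0, ∀ l ∈ Λ, ‖l‖ < r → l = 0) (hγ : IsInducedBy Λ f γ) (hδ : IsInducedBy Λ f δ)
    (θ : eigenforms (translations Λ) k c) : pullback γ θ.1 = pullback δ θ.1 := by
  obtain ⟨l, hl, rfl⟩ := hγ.exists_eq_translation_mul hΛ hδ
  rw [pullback_mul, θ.2.2.1 _ ⟨l, hl, rfl⟩]

/-- A lift to `ℝⁿ` of an isometry of the torus. -/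
noncomputable def lift (f : descend Λ Γ) :
    EuclideanSpace ℝ (Fin n) ≃ᵢ EuclideanSpace ℝ (Fin n) :=
  (exists_isInducedBy_of_mem_descend f.2).choose

theorem isInducedBy_lift (f : descend Λ Γ) : IsInducedBy Λ f.1 (lift f) :=
  (exists_isInducedBy_of_mem_descend f.2).choose_spec.2

/-- The representation of a group of isometries of the torus on the eigenforms. -/
noncomputable def eigenformRep (hΛ : ∃ r > 0, ∀ l ∈ Λ, ‖l‖ < r → l = 0)
    (Γ : Subgroup (EuclideanSpace ℝ (Fin n) ≃ᵢ EuclideanSpace ℝ (Fin n))) (k : ℕ) (c : ℝ) :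
    Representation ℝ (descend Λ Γ) (eigenforms (translations Λ) k c) where
  -- Pullback reverses products, so the inverse is needed for a homomorphism. The chosen lift is
  -- irrelevant, as lattice translations act trivially on these forms.
  toFun f := pullbackEigenforms (isInducedBy_lift f⁻¹).mem_latticeNormalizer
  map_one' := by
    ext1 θ
    refine Subtype.ext ?_
    change pullback (lift (1 : descend Λ Γ)⁻¹) θ.1 = θ.1
    rw [inv_one, pullback_eq_of_isInducedBy hΛ (isInducedBy_lift 1) (fun _ => rfl : IsInducedBy Λ _ 1),
      pullback_one]
  map_mul' f g := by
    ext1 θ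
    refine Subtype.ext ?_
    change pullback (lift (f * g)⁻¹) θ.1 = pullback (lift f⁻¹) (pullback (lift g⁻¹) θ.1)
    rw [← pullback_mul]
    refine pullback_eq_of_isInducedBy hΛ (isInducedBy_lift _) ?_ θ
    rw [mul_inv_rev]
    exact (isInducedBy_lift g⁻¹).mul (isInducedBy_lift f⁻¹)

theorem eigenformRep_apply_of_isInducedBy (hΛ : ∃ r > 0, ∀ l ∈ Λ, ‖l‖ < r → l = 0)
    (f : descend Λ Γ) (h : IsInducedBy Λ (f.1)⁻¹ γ) (θ : eigenforms (translations Λ) k c) :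
    (eigenformRep hΛ Γ k c f θ).1 = pullback γ θ.1 :=
  pullback_eq_of_isInducedBy hΛ (isInducedBy_lift f⁻¹) h θ

/-- The eigenforms on the orbifold `Γ' \ ℝⁿ` are the invariant eigenforms on the torus. -/
noncomputable def invariantsEquiv (hΛ : ∃ r > 0, ∀ l ∈ Λ, ‖l‖ < r → l = 0)
    (h1 : translations Λ ≤ Γ') (h2 : Γ' ≤ Γ) (h3 : Γ ≤ latticeNormalizer Λ) (k : ℕ) (c : ℝ) :
    fixedVectors (V := eigenforms (translations Λ) k c) (eigenformRep hΛ Γ k c)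
      ((descend Λ Γ').subgroupOf (descend Λ Γ)) ≃ₗ[ℝ] eigenforms Γ' k c where
  toFun θ := ⟨θ.1.1, θ.1.2.1, fun γ hγ => by
    obtain ⟨f, hf⟩ := exists_isInducedBy (h3 (h2 hγ))
    have hf' : f ∈ descend Λ Γ' := ⟨γ, hγ, hf⟩
    have h := θ.2 ⟨⟨f, descend_mono h2 hf'⟩⁻¹, inv_mem (Subgroup.mem_subgroupOf.2 hf')⟩
    have h4 := eigenformRep_apply_of_isInducedBy (k := k) (c := c) hΛ
      (⟨f, descend_mono h2 hf'⟩ : descend Λ Γ)⁻¹ (by simpa using hf) θ.1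
    exact h4.symm.trans (congrArg Subtype.val h), θ.1.2.2.2⟩
  map_add' _ _ := rfl
  map_smul' _ _ := rfl
  invFun θ := ⟨⟨θ.1, θ.2.1, fun γ hγ => θ.2.2.1 γ (h1 hγ), θ.2.2.2⟩, fun f => by
    obtain ⟨γ, hγ, hf⟩ := exists_isInducedBy_of_mem_descend (Subgroup.mem_subgroupOf.1 f.2)
    refine Subtype.ext ((eigenformRep_apply_of_isInducedBy hΛ f.1 hf.inv _).trans ?_)
    exact θ.2.2.1 _ (inv_mem hγ)⟩
  left_inv _ := rfl
  right_inv _ := rfl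

/-- Sunada's theorem for flat orbifolds covered by a torus. -/
theorem isospectralOnForms_of_equiv {Γ₁ Γ₂ : Subgroup (EuclideanSpace ℝ (Fin n) ≃ᵢ
    EuclideanSpace ℝ (Fin n))} (hΛ : ∃ r > 0, ∀ l ∈ Λ, ‖l‖ < r → l = 0)
    (hfin : ∀ k c, FiniteDimensional ℝ (eigenforms (translations Λ) k c))
    (h1 : translations Λ ≤ Γ₁) (h2 : translations Λ ≤ Γ₂) (h1' : Γ₁ ≤ Γ) (h2' : Γ₂ ≤ Γ)
    (h3 : Γ ≤ latticeNormalizer Λ)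
    [Finite ((descend Λ Γ₁).subgroupOf (descend Λ Γ))]
    (e : (descend Λ Γ₁).subgroupOf (descend Λ Γ) ≃ (descend Λ Γ₂).subgroupOf (descend Λ Γ))
    (he : ∀ x : (descend Λ Γ₁).subgroupOf (descend Λ Γ), IsConj (x : descend Λ Γ) (e x)) (k : ℕ) : IsospectralOnForms Γ₁ Γ₂ k := by
  intro c
  have := hfin k c
  have e1 := invariantsEquiv hΛ h1 h1' h3 k c
  have e2 := invariantsEquiv hΛ h2 h2' h3 k c
  have := finite_fixedVectors (V := eigenforms (translations Λ) k c) (eigenformRep hΛ Γ k c)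
  have := this ((descend Λ Γ₁).subgroupOf (descend Λ Γ))
  have := finite_fixedVectors (V := eigenforms (translations Λ) k c) (eigenformRep hΛ Γ k c)
    ((descend Λ Γ₂).subgroupOf (descend Λ Γ))
  refine ⟨Module.Finite.equiv e1, Module.Finite.equiv e2, ?_⟩
  rw [← e1.finrank_eq, ← e2.finrank_eq]
  exact finrank_invariants_eq_of_equiv _ e he

end Sunada

/-! ### Recognizing disjoint unions of circles in a quotient -/

section Circles

variable {X : Type*} [PseudoMetricSpace X] {Γ : Subgroup (X ≃ᵢ X)}

/-- Rounding (a - b)/ℓ gives the multiple of ℓ by which a must be shifted to come nearest to b. -/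
theorem AddCircle.exists_coe_eq_abs_sub_eq_dist {ℓ : ℝ} (s t : AddCircle ℓ) :
    ∃ a b : ℝ, (a : AddCircle ℓ) = s ∧ (b : AddCircle ℓ) = t ∧ |a - b| = dist s t := by
  obtain ⟨a, rfl⟩ := QuotientAddGroup.mk_surjective s
  obtain ⟨b, rfl⟩ := QuotientAddGroup.mk_surjective t
  refine ⟨a - round (ℓ⁻¹ * (a - b)) * ℓ, b, ?_, rfl, ?_⟩
  · rw [← sub_eq_zero, ← AddCircle.coe_sub, AddCircle.coe_eq_zero_iff]
    exact ⟨-round (ℓ⁻¹ * (a - b)), by simp⟩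
  · rw [dist_eq_norm, ← AddCircle.coe_sub, AddCircle.norm_eq]
    congr 1
    ring

/-- Because Γ acts by isometries, one of the two orbit representatives may be held fixed. -/
theorem orbitDist_eq_of_forall_le {x y : X} (h : ∀ γ ∈ Γ, dist x y ≤ dist x (γ y)) :
    orbitDist Γ (proj Γ x) (proj Γ y) = dist x y := by
  refine IsLeast.csInf_eq ⟨⟨x, y, rfl, rfl, rfl⟩, ?_⟩
  rintro _ ⟨x', y', hx, hy, rfl⟩
  obtain ⟨γ, hγ, rfl⟩ := proj_eq_proj_iff.1 hx
  obtain ⟨δ, hδ, rfl⟩ := proj_eq_proj_iff.1 hy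
  refine (h (γ⁻¹ * δ) (mul_mem (inv_mem hγ) hδ)).trans_eq ?_
  rw [← γ.dist_eq]
  congr 1
  exact γ.apply_symm_apply _

/-- A family of isometrically embedded lines whose images in `Γ \ X` close up with period `ℓ` and
are otherwise disjoint gives a disjoint union of circles of length `ℓ`. -/
theorem isDisjointUnionOfCircles_of_curves [T2Space (OrbitSpace Γ)] {S : Set (OrbitSpace Γ)}
    {m : ℕ} {ℓ ε : ℝ} (hℓ : 0 < ℓ) (hε : 0 < ε) {c : Fin m → ℝ → X} (hc : ∀ i, Isometry (c i))
    (hS : ∀ p, p ∈ S ↔ ∃ i s, proj Γ (c i s) = p)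
    (horb : ∀ i j s t, proj Γ (c i s) = proj Γ (c j t) ↔ i = j ∧ (s : AddCircle ℓ) = t)
    (hdist : ∀ i s t, ∀ γ ∈ Γ, |s - t| < ε → |s - t| ≤ dist (c i s) (γ (c i t))) :
    IsDisjointUnionOfCircles Γ S m ℓ := by
  have : Fact (0 < ℓ) := ⟨hℓ⟩
  let f (i : Fin m) : AddCircle ℓ → S := Quotient.lift
    (fun s => ⟨proj Γ (c i s), (hS _).2 ⟨i, s, rfl⟩⟩) fun s t h =>
      Subtype.ext ((horb i i s t).2 ⟨rfl, Quotient.sound h⟩)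
  have hf : ∀ i, Continuous (f i) := fun i =>
    Continuous.quotient_lift (((continuous_proj Γ).comp (hc i).continuous).subtype_mk _) _
  let g : Fin m × AddCircle ℓ → S := fun p => f p.1 p.2
  have hg : Continuous g := continuous_prod_of_discrete_left.2 hf
  have hb : Function.Bijective g := by
    constructor
    · rintro ⟨i, ⟨s⟩⟩ ⟨j, ⟨t⟩⟩ h
      obtain ⟨h1, h2⟩ := (horb i j s t).1 (congrArg Subtype.val h)
      exact Prod.ext h1 h2
    · rintro ⟨p, hp⟩
      obtain ⟨i, s, rfl⟩ := (hS p).1 hp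
      exact ⟨(i, (s : AddCircle ℓ)), rfl⟩
  -- The radius ε/2 keeps two points of the ball less than ε apart, as `hdist` requires.
  refine ⟨Continuous.homeoOfEquivCompactToT2 (f := Equiv.ofBijective g hb) hg, fun i t =>
    ⟨Metric.ball t (ε / 2), Metric.ball_mem_nhds t (by positivity), fun s hs s' hs' => ?_⟩⟩
  obtain ⟨a, b, rfl, rfl, hab⟩ := AddCircle.exists_coe_eq_abs_sub_eq_dist s s'
  change orbitDist Γ (proj Γ (c i a)) (proj Γ (c i b)) = _
  rw [← hab, ← Real.dist_eq, ← (hc i).dist_eq a b]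
  refine orbitDist_eq_of_forall_le fun γ hγ => ?_
  rw [(hc i).dist_eq, Real.dist_eq]
  refine hdist i a b γ hγ ?_
  rw [hab]
  have h1 := dist_triangle_right (a : AddCircle ℓ) b t
  have h2 := Metric.mem_ball.1 hs
  have h3 := Metric.mem_ball.1 hs'
  linarith

/-- Each circle is connected, so the homeomorphism sends it into a single circle; surjectivity
bounds the number of target circles. -/
theorem IsDisjointUnionOfCircles.le_of_homeomorph {Y : Type*} [PseudoMetricSpace Y]
    {Γ' : Subgroup (Y ≃ᵢ Y)} {S : Set (OrbitSpace Γ)} {S' : Set (OrbitSpace Γ')} {m m' : ℕ}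
    {ℓ ℓ' : ℝ} (h : IsDisjointUnionOfCircles Γ S m ℓ) (h' : IsDisjointUnionOfCircles Γ' S' m' ℓ')
    (e : S ≃ₜ S') : m' ≤ m := by
  obtain ⟨f, -⟩ := h
  obtain ⟨f', -⟩ := h'
  let F : Fin m × AddCircle ℓ ≃ₜ Fin m' × AddCircle ℓ' := (f.trans e).trans f'.symm
  have hF : ∀ i (t : AddCircle ℓ), (F (i, t)).1 = (F (i, 0)).1 := fun i t =>
    (IsLocallyConstant.iff_continuous _).2 (continuous_fst.comp
      (F.continuous.comp (Continuous.prodMk_right i))) |>.apply_eq_of_preconnectedSpace t 0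
  have hs : Function.Surjective fun i : Fin m => (F (i, 0)).1 := fun j => by
    obtain ⟨⟨i, t⟩, hp⟩ := F.surjective (j, 0)
    exact ⟨i, by simp only [← hF i t, hp]⟩
  simpa using Fintype.card_le_of_surjective _ hs

end Circles

/-! ### Groups generated by linear parts and translations -/

section Normalizer

variable {n : ℕ} {Λ Λ' : AddSubgroup (EuclideanSpace ℝ (Fin n))}
  {K : Subgroup (EuclideanSpace ℝ (Fin n) ≃ᵢ EuclideanSpace ℝ (Fin n))}
  {γ δ : EuclideanSpace ℝ (Fin n) ≃ᵢ EuclideanSpace ℝ (Fin n)}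

theorem latticeNormalizer_le_normalizer :
    latticeNormalizer Λ ≤ Subgroup.normalizer (translations Λ : Set _) := by
  have key : ∀ γ ∈ latticeNormalizer Λ, ∀ δ ∈ translations Λ, γ * δ * γ⁻¹ ∈ translations Λ := by
    rintro γ hγ _ ⟨l, hl, rfl⟩
    rw [mul_L_eq, mul_inv_cancel_right]
    exact ⟨_, (hγ 0 l).1 hl, rfl⟩
  intro γ hγ
  rw [Subgroup.mem_normalizer_iff]
  refine fun δ => ⟨key γ hγ δ, fun h => ?_⟩
  have h1 := key γ⁻¹ (inv_mem hγ) _ h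
  simpa [mul_assoc] using h1

/-- K normalizes the translation group, so the join is the set of products. -/
theorem mem_sup_translations_iff (hK : K ≤ latticeNormalizer Λ) :
    γ ∈ K ⊔ translations Λ ↔ ∃ B ∈ K, ∃ b ∈ Λ, γ = B * L b := by
  rw [← SetLike.mem_coe,
    Subgroup.coe_mul_of_left_le_normalizer_right _ _ (hK.trans latticeNormalizer_le_normalizer)]
  constructor
  · rintro ⟨B, hB, _, ⟨b, hb, rfl⟩, rfl⟩
    exact ⟨B, hB, b, hb, rfl⟩
  · rintro ⟨B, hB, b, hb, rfl⟩
    exact ⟨B, hB, L b, ⟨b, hb, rfl⟩, rfl⟩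

theorem IsInducedBy.of_sub_mem {f : Torus Λ ≃ᵢ Torus Λ} (hf : IsInducedBy Λ f γ)
    (h : ∀ x, δ x - γ x ∈ Λ) : IsInducedBy Λ f δ := fun x => by
  rw [hf x, QuotientAddGroup.eq, ← sub_eq_neg_add]
  exact h x

end Normalizer

/-! ### The group H as signed permutations; finiteness of G -/

section SignedPermutations

/-- The isometries which permute the coordinates `frame` up to sign. -/
def signedPerm : Subgroup (E3 ≃ᵢ E3) where
  carrier := {γ | ∃ (σ : Equiv.Perm (Fin 3)) (ε : Fin 3 → ℤˣ),
    ∀ y, γ (frame y) = frame fun i => ((ε i : ℤ) : ℝ) * y (σ i)}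
  one_mem' := ⟨1, 1, fun y => by simp⟩
  mul_mem' := by
    rintro γ δ ⟨σ, ε, h⟩ ⟨σ', ε', h'⟩
    refine ⟨σ.trans σ', fun i => ε i * ε' (σ i), fun y => ?_⟩
    change γ (δ (frame y)) = _
    rw [h', h]
    simp [mul_assoc]
  inv_mem' := by
    rintro γ ⟨σ, ε, h⟩
    refine ⟨σ.symm, fun i => ε (σ.symm i), fun y => ?_⟩
    change γ.symm (frame y) = _
    rw [IsometryEquiv.symm_apply_eq, h]
    congr 1
    funext i
    rcases Int.units_eq_one_or (ε i) with h1 | h1 <;> simp [h1]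

/-- An element is determined by the images of the three frame vectors, which come from finitely many
pairs (σ, ε). -/
theorem finite_signedPerm : (signedPerm : Set (E3 ≃ᵢ E3)).Finite := by
  refine Set.Finite.of_injOn (f := fun γ : E3 ≃ᵢ E3 => fun i : Fin 3 => γ (frame (Pi.single i 1)))
    (t := Set.range fun p : Equiv.Perm (Fin 3) × (Fin 3 → ℤˣ) => fun j : Fin 3 =>
      frame fun i => ((p.2 i : ℤ) : ℝ) * (Pi.single j 1 : Fin 3 → ℝ) (p.1 i)) ?_ ?_
    (Set.finite_range _)
  · rintro γ ⟨σ, ε, h⟩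
    exact ⟨(σ, ε), funext fun j => (h _).symm⟩
  · rintro γ ⟨σ, ε, h⟩ δ ⟨σ', ε', h'⟩ e
    ext1 x
    obtain ⟨y, rfl⟩ := frame.surjective x
    rw [h, h']
    congr 1
    funext i
    have e1 : ∀ j, ((ε i : ℤ) : ℝ) * (Pi.single j 1 : Fin 3 → ℝ) (σ i) =
        ((ε' i : ℤ) : ℝ) * (Pi.single j 1 : Fin 3 → ℝ) (σ' i) := fun j => by
      have e2 := congrFun e j
      simp only [h, h'] at e2
      exact congrFun (frame.injective e2) i
    have e3 := e1 (σ i)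
    by_cases hs : σ' i = σ i
    · rw [hs] at e3 ⊢
      simpa using Or.inl e3
    · rcases Int.units_eq_one_or (ε i) with h1 | h1 <;> simp [hs, h1] at e3

theorem signedPerm_map_add {γ : E3 ≃ᵢ E3} (hγ : γ ∈ signedPerm) (x y : E3) :
    γ (x + y) = γ x + γ y := by
  obtain ⟨σ, ε, h⟩ := hγ
  obtain ⟨x, rfl⟩ := frame.surjective x
  obtain ⟨y, rfl⟩ := frame.surjective y
  rw [← map_add, h, h, h, ← map_add]
  congr 1
  funext i
  simp [mul_add]

/-- The parameter a covers Λ' (a = 1) and Λ'/4 (a = 4) at once: the condition treats all coordinates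
alike and is insensitive to signs. -/
theorem signedPerm_mem_iff {Λ : AddSubgroup E3} {a : ℝ}
    (hΛ : ∀ y, frame y ∈ Λ ↔ ∀ i, ∃ l : ℤ, a * y i = l) {γ : E3 ≃ᵢ E3} (hγ : γ ∈ signedPerm)
    (x : E3) : x ∈ Λ ↔ γ x ∈ Λ := by
  have key : ∀ γ ∈ signedPerm, ∀ x ∈ Λ, γ x ∈ Λ := by
    rintro γ ⟨σ, ε, h⟩ x hx
    obtain ⟨y, rfl⟩ := frame.surjective x
    rw [h, hΛ]
    intro i
    obtain ⟨l, hl⟩ := (hΛ y).1 hx (σ i)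
    exact ⟨ε i * l, by push_cast; rw [← hl]; ring⟩
  refine ⟨key γ hγ x, fun h => ?_⟩
  have h1 := key γ⁻¹ (inv_mem hγ) _ h
  rwa [show γ⁻¹ (γ x) = x from γ.symm_apply_apply x] at h1

theorem signedPerm_le_latticeNormalizer {Λ : AddSubgroup E3} {a : ℝ}
    (hΛ : ∀ y, frame y ∈ Λ ↔ ∀ i, ∃ l : ℤ, a * y i = l) : signedPerm ≤ latticeNormalizer Λ := by
  intro γ hγ x l
  rw [signedPerm_map_add hγ, add_sub_cancel_left]
  exact signedPerm_mem_iff hΛ hγ l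

theorem signedPerm_le_latticeNormalizer_lattice' : signedPerm ≤ latticeNormalizer lattice' :=
  signedPerm_le_latticeNormalizer (a := 1) fun y => by simp [frame_mem_lattice']

theorem signedPerm_le_latticeNormalizer_quarterLattice' :
    signedPerm ≤ latticeNormalizer quarterLattice' :=
  signedPerm_le_latticeNormalizer fun _ => frame_mem_quarterLattice'

theorem τ_frame (y : Fin 3 → ℝ) : τ (frame y) = frame ![-y 0, y 1, -y 2] := by
  change WithLp.toLp 2 (_ *ᵥ _) = _
  ext i
  fin_cases i <;> simp [Matrix.mulVec, dotProduct, Fin.sum_univ_three] <;> ring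

theorem ρ_frame (y : Fin 3 → ℝ) : ρ (frame y) = frame ![-y 0, -y 1, y 2] := by
  change WithLp.toLp 2 (_ *ᵥ _) = _
  ext i
  fin_cases i <;> simp [Matrix.mulVec, dotProduct, Fin.sum_univ_three] <;> ring

/-- A carries the axis of τ (coordinate 1) to that of ρ (coordinate 2). -/
theorem A_frame (y : Fin 3 → ℝ) : A (frame y) = frame ![y 2, -y 0, y 1] := by
  have h : (√2 : ℝ) * √2 = 2 := Real.mul_self_sqrt (by norm_num)
  have h0 : (√2 : ℝ) ≠ 0 := by positivity
  change WithLp.toLp 2 (_ *ᵥ _) = _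
  ext i
  fin_cases i <;> simp [Matrix.mulVec, dotProduct, Fin.sum_univ_three] <;> field_simp <;>
    first | ring1 | linear_combination (-y 1) * h

theorem τ_mem_signedPerm : τ ∈ signedPerm := ⟨1, ![-1, 1, -1], fun y => by
  rw [τ_frame]
  congr 1
  funext i
  fin_cases i <;> simp⟩

theorem ρ_mem_signedPerm : ρ ∈ signedPerm := ⟨1, ![-1, -1, 1], fun y => by
  rw [ρ_frame]
  congr 1
  funext i
  fin_cases i <;> simp⟩

theorem A_mem_signedPerm : A ∈ signedPerm := ⟨Equiv.subRight 1, ![1, -1, 1], fun y => by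
  rw [A_frame]
  congr 1
  funext i
  fin_cases i <;> simp [show (-1 : Fin 3) = 2 from rfl]⟩

theorem H_le_signedPerm : H ≤ signedPerm := by
  rw [H, Subgroup.closure_le]
  rintro _ (rfl | rfl | rfl)
  · exact τ_mem_signedPerm
  · exact ρ_mem_signedPerm
  · exact A_mem_signedPerm

theorem mem_ambient_iff {γ : E3 ≃ᵢ E3} : γ ∈ H ⊔ translations quarterLattice' ↔
    ∃ B ∈ H, ∃ b ∈ quarterLattice', γ = B * L b :=
  mem_sup_translations_iff (H_le_signedPerm.trans signedPerm_le_latticeNormalizer_quarterLattice')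

theorem G_eq : (G : Set (Torus lattice' ≃ᵢ Torus lattice')) =
    {f | ∃ B ∈ H, ∃ b : E3, 4 • b ∈ lattice' ∧ IsInducedBy lattice' f (B * L b)} := by
  ext f
  constructor
  · rintro ⟨γ, hγ, hf⟩
    obtain ⟨B, hB, b, hb, rfl⟩ := mem_ambient_iff.1 hγ
    exact ⟨B, hB, b, hb, hf⟩
  · rintro ⟨B, hB, b, hb, hf⟩
    exact ⟨B * L b, mem_ambient_iff.2 ⟨B, hB, b, hb, rfl⟩, hf⟩

theorem ambient_le_latticeNormalizer :
    H ⊔ translations quarterLattice' ≤ latticeNormalizer lattice' :=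
  sup_le (H_le_signedPerm.trans signedPerm_le_latticeNormalizer_lattice')
    (translations_le_latticeNormalizer _)

theorem finite_G : Finite G := by
  have h1 : (H : Set (E3 ≃ᵢ E3)).Finite := finite_signedPerm.subset H_le_signedPerm
  -- These 64 vectors represent Λ'/4 modulo Λ'; with the finite group H they account for every
  -- element of G.
  let b (q : Fin 3 → Fin 4) : E3 := frame fun i => ((q i : ℕ) : ℝ) / 4
  have h2 : (⋃ B ∈ (H : Set (E3 ≃ᵢ E3)), ⋃ q : Fin 3 → Fin 4,
      {f : Torus lattice' ≃ᵢ Torus lattice' | IsInducedBy lattice' f (B * L (b q))}).Finite :=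
    h1.biUnion fun B _ => Set.finite_iUnion fun q =>
      Set.Subsingleton.finite fun f hf g hg => IsInducedBy.eq hf hg
  refine Set.Finite.to_subtype (h2.subset fun f hf => ?_)
  rw [G_eq] at hf
  obtain ⟨B, hB, x, hx, hf⟩ := hf
  obtain ⟨y, rfl⟩ := frame.surjective x
  choose l hl using frame_mem_quarterLattice'.1 hx
  simp only [Set.mem_iUnion]
  refine ⟨B, hB, fun i => ⟨(l i % 4).toNat, by omega⟩, hf.of_sub_mem fun x => ?_⟩
  have hB' := H_le_signedPerm hB
  change B (x + _) - B (x + _) ∈ _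
  rw [signedPerm_map_add hB', signedPerm_map_add hB', add_sub_add_left_eq_sub]
  have e : ∀ u v, B (u - v) = B u - B v := fun u v => by
    rw [eq_sub_iff_add_eq, ← signedPerm_map_add hB', sub_add_cancel]
  rw [← e, ← signedPerm_mem_iff (a := 1) (fun y => by simp [frame_mem_lattice']) hB']
  change frame _ - frame y ∈ lattice'
  rw [← map_sub frame, frame_mem_lattice']
  intro i
  refine ⟨-(l i / 4), ?_⟩
  have h3 : ((l i % 4).toNat : ℤ) + 4 * (l i / 4) = l i := by omega
  have h4 : (((l i % 4).toNat : ℤ) : ℝ) + 4 * ((l i / 4 : ℤ) : ℝ) = l i := by exact_mod_cast h3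
  simp only [Pi.sub_apply, Int.cast_neg]
  rw [Int.cast_natCast] at h4
  linarith [hl i]

end SignedPermutations

/-! ### Discreteness, compactness and the index of Λ' in Λ -/

section LatticeFacts

theorem lattice'_separated : ∃ r > 0, ∀ l ∈ lattice', ‖l‖ < r → l = 0 := by
  refine ⟨1, one_pos, fun x hx hn => ?_⟩
  obtain ⟨y, rfl⟩ := frame.surjective x
  choose l hl using frame_mem_lattice'.1 hx
  have : y = 0 := funext fun i => by
    have h1 := (abs_le_norm_frame y i).trans_lt hn
    rw [hl i] at h1 ⊢
    have h2 : |l i| < 1 := by exact_mod_cast h1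
    simp [Int.abs_lt_one_iff.1 h2]
  rw [this, map_zero]

theorem finite_lattice_inter_ball (R : ℝ) : {l ∈ lattice | ‖l‖ ≤ R}.Finite := by
  -- Frame coordinates of lattice vectors are half-integers bounded by the norm.
  refine ((Set.Finite.pi' fun _ : Fin 3 => Set.finite_Icc (-⌈2 * R⌉) ⌈2 * R⌉).image
    fun q : Fin 3 → ℤ => frame fun i => (q i : ℝ) / 2).subset ?_
  rintro x ⟨hx, hn⟩
  obtain ⟨y, rfl⟩ := frame.surjective x
  obtain ⟨⟨a, ha⟩, ⟨b, hb⟩, ⟨c, hc⟩⟩ := frame_mem_lattice.1 hx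
  have h2 : ∀ i, ∃ q : ℤ, 2 * y i = q := by
    intro i
    fin_cases i
    · exact ⟨a + b, by push_cast; rw [← ha, ← hb]; simp; ring⟩
    · exact ⟨a - b, by push_cast; rw [← ha, ← hb]; simp; ring⟩
    · exact ⟨c, hc⟩
  choose q hq using h2
  refine ⟨q, fun i => ?_, ?_⟩
  · have h3 := (abs_le_norm_frame y i).trans hn
    rw [abs_le] at h3
    have h4 : (q i : ℝ) ≤ ⌈2 * R⌉ := by linarith [Int.le_ceil (2 * R), hq i]
    have h5 : (-⌈2 * R⌉ : ℝ) ≤ q i := by linarith [Int.le_ceil (2 * R), hq i]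
    exact ⟨by exact_mod_cast h5, by exact_mod_cast h4⟩
  · dsimp only
    congr 1
    funext i
    rw [← hq i]
    ring

theorem exists_add_mem_lattice' (x : E3) :
    ∃ l ∈ lattice', x + l ∈ frame '' Set.Icc (0 : Fin 3 → ℝ) 1 := by
  obtain ⟨y, rfl⟩ := frame.surjective x
  refine ⟨frame fun i => ((-⌊y i⌋ : ℤ) : ℝ), frame_mem_lattice'.2 fun i => ⟨_, rfl⟩,
    fun i => Int.fract (y i), ⟨fun i => Int.fract_nonneg _, fun i => (Int.fract_lt_one _).le⟩, ?_⟩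
  rw [← map_add]
  congr 1
  funext i
  simp [Int.fract, sub_eq_add_neg]

theorem compactSpace_torus : CompactSpace (Torus lattice') := by
  have h1 : IsCompact ((QuotientAddGroup.mk : E3 → Torus lattice') ''
      (frame '' Set.Icc (0 : Fin 3 → ℝ) 1)) :=
    (isCompact_Icc.image frame.continuous).image continuous_quotient_mk'
  refine ⟨h1.of_isClosed_subset isClosed_univ ?_⟩
  rintro ⟨x⟩ -
  obtain ⟨l, hl, h⟩ := exists_add_mem_lattice' x
  refine ⟨x + l, h, ?_⟩
  change ((x + l : E3) : Torus lattice') = (x : Torus lattice')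
  rw [QuotientAddGroup.eq]
  simpa using hl

theorem compactSpace_orbitSpace {Γ : Subgroup (E3 ≃ᵢ E3)} (h : translations lattice' ≤ Γ) :
    CompactSpace (OrbitSpace Γ) := by
  have h1 : IsCompact (proj Γ '' (frame '' Set.Icc (0 : Fin 3 → ℝ) 1)) :=
    (isCompact_Icc.image frame.continuous).image (continuous_proj Γ)
  refine ⟨h1.of_isClosed_subset isClosed_univ ?_⟩
  rintro ⟨x⟩ -
  obtain ⟨l, hl, h2⟩ := exists_add_mem_lattice' x
  exact ⟨x + l, h2, proj_eq_proj_iff.2 ⟨L l, h ⟨l, hl, rfl⟩, rfl⟩⟩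

/-- Representatives of `lattice` modulo `lattice'`. -/
noncomputable def latticeRep (p : Fin 2 × Fin 2) : E3 :=
  frame ![((p.1 : ℕ) : ℝ) / 2, ((p.1 : ℕ) : ℝ) / 2, ((p.2 : ℕ) : ℝ) / 2]

theorem latticeRep_mem (p : Fin 2 × Fin 2) : latticeRep p ∈ lattice :=
  frame_mem_lattice.2 ⟨⟨(p.1 : ℕ), by simp⟩, ⟨0, by simp⟩, ⟨(p.2 : ℕ), by simp; ring⟩⟩

theorem exists_sub_latticeRep_mem {x : E3} (hx : x ∈ lattice) :
    ∃ p, x - latticeRep p ∈ lattice' := by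
  obtain ⟨y, rfl⟩ := frame.surjective x
  obtain ⟨⟨a, ha⟩, ⟨b, hb⟩, ⟨c, hc⟩⟩ := frame_mem_lattice.1 hx
  -- The first two frame coordinates are (a+b)/2 and (a-b)/2, whose numerators have the same parity;
  -- one bit m serves both, and k is the parity of c.
  obtain ⟨m, hm⟩ : ∃ m : Fin 2, (a + b) % 2 = (m : ℕ) :=
    ⟨⟨((a + b) % 2).toNat, by omega⟩, by simp; omega⟩
  obtain ⟨k, hk⟩ : ∃ k : Fin 2, c % 2 = (k : ℕ) := ⟨⟨(c % 2).toNat, by omega⟩, by simp; omega⟩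
  refine ⟨(m, k), ?_⟩
  rw [latticeRep, ← map_sub frame, frame_mem_lattice']
  have h1 : a + b = 2 * ((a + b) / 2) + (m : ℕ) := by omega
  have h2 : a - b = 2 * ((a + b) / 2 - b) + (m : ℕ) := by omega
  have h3 : c = 2 * (c / 2) + (k : ℕ) := by omega
  have h1' : (a : ℝ) + b = 2 * ((a + b) / 2 : ℤ) + (m : ℕ) := by exact_mod_cast h1
  have h2' : (a : ℝ) - b = 2 * (((a + b) / 2 - b : ℤ) : ℝ) + (m : ℕ) := by exact_mod_cast h2
  have h3' : (c : ℝ) = 2 * (c / 2 : ℤ) + (k : ℕ) := by exact_mod_cast h3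
  intro i
  fin_cases i
  · refine ⟨(a + b) / 2, ?_⟩
    change y 0 - ((m : ℕ) : ℝ) / 2 = _
    linarith
  · refine ⟨(a + b) / 2 - b, ?_⟩
    change y 1 - ((m : ℕ) : ℝ) / 2 = _
    linarith
  · refine ⟨c / 2, ?_⟩
    change y 2 - ((k : ℕ) : ℝ) / 2 = _
    linarith

theorem latticeRep_injective {p q : Fin 2 × Fin 2} (h : latticeRep p - latticeRep q ∈ lattice') :
    p = q := by
  rw [latticeRep, latticeRep, ← map_sub frame, frame_mem_lattice'] at h
  have key : ∀ m m' : Fin 2, (∃ l : ℤ, ((m : ℕ) : ℝ) / 2 - ((m' : ℕ) : ℝ) / 2 = l) → m = m' := by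
    rintro m m' ⟨l, hl⟩
    have h1 : ((m : ℕ) : ℝ) = 2 * l + (m' : ℕ) := by linarith
    have h2 : ((m : ℕ) : ℤ) = 2 * l + (m' : ℕ) := by exact_mod_cast h1
    omega
  exact Prod.ext (key _ _ (by simpa using h 0)) (key _ _ (by simpa using h 2))

theorem relIndex_lattice' : lattice'.relIndex lattice = 4 := by
  rw [AddSubgroup.relIndex, AddSubgroup.index]
  have h : Function.Bijective fun p : Fin 2 × Fin 2 =>
      ((⟨latticeRep p, latticeRep_mem p⟩ : lattice) : lattice ⧸ lattice'.addSubgroupOf lattice) := by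
    constructor
    · intro p q hpq
      rw [QuotientAddGroup.eq, AddSubgroup.mem_addSubgroupOf] at hpq
      refine (latticeRep_injective ?_).symm
      simpa [sub_eq_neg_add] using hpq
    · rintro ⟨⟨x, hx⟩⟩
      obtain ⟨p, hp⟩ := exists_sub_latticeRep_mem hx
      refine ⟨p, ?_⟩
      refine QuotientAddGroup.eq.2 (AddSubgroup.mem_addSubgroupOf.2 ?_)
      simpa [sub_eq_neg_add] using hp
  rw [← Nat.card_eq_of_bijective _ h]
  simp

end LatticeFacts

/-! ### Groups generated by Λ and a half-turn: isotropy and proper discontinuity -/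

section HalfTurn

/-- A linear isometry of order two that preserves `lattice`. -/
structure IsHalfTurn (κ : E3 ≃ᵢ E3) : Prop where
  mem_signedPerm : κ ∈ signedPerm
  mul_self : κ * κ = 1
  ne_one : κ ≠ 1
  map_mem : ∀ l ∈ lattice, κ l ∈ lattice

/-- The group generated by the translations by `lattice` and `κ`. -/
noncomputable def halfTurnGroup (κ : E3 ≃ᵢ E3) : Subgroup (E3 ≃ᵢ E3) :=
  translations lattice ⊔ Subgroup.closure {κ}

theorem isHalfTurn_τ : IsHalfTurn τ where
  mem_signedPerm := τ_mem_signedPerm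
  mul_self := by
    ext1 x
    obtain ⟨y, rfl⟩ := frame.surjective x
    change τ (τ (frame y)) = frame y
    rw [τ_frame, τ_frame]
    congr 1
    ext i; fin_cases i <;> simp
  ne_one h := by
    have h1 := τ_frame ![1, 0, 0]
    rw [h] at h1
    have h2 := congrFun (frame.injective h1) 0
    norm_num at h2
  map_mem x hx := by
    obtain ⟨y, rfl⟩ := frame.surjective x
    obtain ⟨⟨a, ha⟩, ⟨b, hb⟩, ⟨c, hc⟩⟩ := frame_mem_lattice.1 hx
    rw [τ_frame, frame_mem_lattice]
    refine ⟨⟨-b, ?_⟩, ⟨-a, ?_⟩, ⟨-c, ?_⟩⟩ <;> simp <;> linarith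

theorem isHalfTurn_ρ : IsHalfTurn ρ where
  mem_signedPerm := ρ_mem_signedPerm
  mul_self := by
    ext1 x
    obtain ⟨y, rfl⟩ := frame.surjective x
    change ρ (ρ (frame y)) = frame y
    rw [ρ_frame, ρ_frame]
    congr 1
    ext i; fin_cases i <;> simp
  ne_one h := by
    have h1 := ρ_frame ![1, 0, 0]
    rw [h] at h1
    have h2 := congrFun (frame.injective h1) 0
    norm_num at h2
  map_mem x hx := by
    obtain ⟨y, rfl⟩ := frame.surjective x
    obtain ⟨⟨a, ha⟩, ⟨b, hb⟩, ⟨c, hc⟩⟩ := frame_mem_lattice.1 hx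
    rw [ρ_frame, frame_mem_lattice]
    refine ⟨⟨-a, ?_⟩, ⟨-b, ?_⟩, ⟨c, ?_⟩⟩ <;> simp <;> linarith

variable {κ : E3 ≃ᵢ E3}

namespace IsHalfTurn

theorem map_add (h : IsHalfTurn κ) (x y : E3) : κ (x + y) = κ x + κ y :=
  signedPerm_map_add h.mem_signedPerm x y

theorem map_sub (h : IsHalfTurn κ) (x y : E3) : κ (x - y) = κ x - κ y := by
  rw [eq_sub_iff_add_eq, ← h.map_add, sub_add_cancel]

theorem apply_apply (h : IsHalfTurn κ) (x : E3) : κ (κ x) = x :=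
  congrArg (fun γ : E3 ≃ᵢ E3 => γ x) h.mul_self

theorem mem_iff (h : IsHalfTurn κ) (l : E3) : l ∈ lattice ↔ κ l ∈ lattice :=
  ⟨h.map_mem l, fun h1 => by simpa [h.apply_apply] using h.map_mem _ h1⟩

theorem inv_eq (h : IsHalfTurn κ) : κ⁻¹ = κ := inv_eq_of_mul_eq_one_right h.mul_self

theorem mem_closure_iff (h : IsHalfTurn κ) {γ : E3 ≃ᵢ E3} :
    γ ∈ Subgroup.closure {κ} ↔ ∃ j : Fin 2, γ = κ ^ (j : ℕ) := by
  constructor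
  · intro hγ
    induction hγ using Subgroup.closure_induction with
    | mem x hx => exact ⟨1, by simpa using hx⟩
    | one => exact ⟨0, by simp⟩
    | mul x y _ _ hx hy =>
      obtain ⟨i, rfl⟩ := hx
      obtain ⟨j, rfl⟩ := hy
      refine ⟨i + j, ?_⟩
      fin_cases i <;> fin_cases j <;> simp [h.mul_self]
    | inv x _ hx =>
      obtain ⟨i, rfl⟩ := hx
      refine ⟨i, ?_⟩
      fin_cases i <;> simp [h.inv_eq]
  · rintro ⟨j, rfl⟩
    exact Subgroup.pow_mem _ (Subgroup.mem_closure_singleton_self κ) _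

theorem mem_iff_exists_pow (h : IsHalfTurn κ) {γ : E3 ≃ᵢ E3} :
    γ ∈ halfTurnGroup κ ↔ ∃ j : Fin 2, ∃ l ∈ lattice, γ = κ ^ (j : ℕ) * L l := by
  have h1 : Subgroup.closure {κ} ≤ latticeNormalizer lattice := by
    rw [Subgroup.closure_le]
    intro γ hγ
    rw [Set.mem_singleton_iff.1 hγ]
    refine mem_latticeNormalizer.2 fun x l => ?_
    rw [show κ (x + l) - κ x = κ l by rw [h.map_add x l]; exact add_sub_cancel_left _ _]
    exact h.mem_iff l
  rw [halfTurnGroup, sup_comm, mem_sup_translations_iff h1]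
  constructor
  · rintro ⟨B, hB, l, hl, rfl⟩
    obtain ⟨j, rfl⟩ := h.mem_closure_iff.1 hB
    exact ⟨j, l, hl, rfl⟩
  · rintro ⟨j, l, hl, rfl⟩
    exact ⟨_, h.mem_closure_iff.2 ⟨j, rfl⟩, l, hl, rfl⟩

theorem mem_group_iff (h : IsHalfTurn κ) {γ : E3 ≃ᵢ E3} :
    γ ∈ halfTurnGroup κ ↔ (∃ l ∈ lattice, γ = L l) ∨ ∃ l ∈ lattice, γ = κ * L l := by
  rw [h.mem_iff_exists_pow]
  constructor
  · rintro ⟨j, l, hl, rfl⟩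
    fin_cases j
    · exact Or.inl ⟨l, hl, by simp⟩
    · exact Or.inr ⟨l, hl, by simp⟩
  · rintro (⟨l, hl, rfl⟩ | ⟨l, hl, rfl⟩)
    · exact ⟨0, l, hl, by simp⟩
    · exact ⟨1, l, hl, by simp⟩

theorem coe_group_eq (h : IsHalfTurn κ) : (halfTurnGroup κ : Set (E3 ≃ᵢ E3)) =
    {γ | ∃ j : Fin 2, ∃ l ∈ lattice, γ = κ ^ (j : ℕ) * L l} :=
  Set.ext fun _ => h.mem_iff_exists_pow

theorem coe_descend_eq (h : IsHalfTurn κ) :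
    (descend lattice' (halfTurnGroup κ) : Set (Torus lattice' ≃ᵢ Torus lattice')) =
    {f | ∃ j : Fin 2, ∃ l ∈ lattice, IsInducedBy lattice' f (κ ^ (j : ℕ) * L l)} := by
  ext f
  constructor
  · rintro ⟨γ, hγ, hf⟩
    obtain ⟨j, l, hl, rfl⟩ := h.mem_iff_exists_pow.1 hγ
    exact ⟨j, l, hl, hf⟩
  · rintro ⟨j, l, hl, hf⟩
    exact ⟨_, h.mem_iff_exists_pow.2 ⟨j, l, hl, rfl⟩, hf⟩

theorem translations_le : translations lattice' ≤ halfTurnGroup κ := by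
  refine le_trans ?_ (le_sup_left : translations lattice ≤ _)
  rintro _ ⟨l, hl, rfl⟩
  exact ⟨l, lattice'_le_lattice hl, rfl⟩

theorem le_ambient (hκ : κ ∈ H) : halfTurnGroup κ ≤ H ⊔ translations quarterLattice' := by
  refine sup_le (le_trans ?_ le_sup_right) (le_trans ?_ le_sup_left)
  · rintro _ ⟨l, hl, rfl⟩
    exact ⟨l, lattice_le_quarterLattice' hl, rfl⟩
  · rw [Subgroup.closure_le]
    rintro _ rfl
    exact hκ

/-- κ is linear and preserves norms. If L_l or κL_l takes a point of norm at most R to another such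
point, then ‖l‖ ≤ 2R, leaving finitely many l. -/
theorem properlyDiscontinuousSMul (h : IsHalfTurn κ) :
    ProperlyDiscontinuousSMul (halfTurnGroup κ) E3 := by
  refine ⟨fun {K K'} hK hK' => ?_⟩
  obtain ⟨R, hR⟩ := (hK.union hK').isBounded.exists_norm_le
  have hf := (finite_lattice_inter_ball (2 * R)).image fun l => L l
  have hf' := (finite_lattice_inter_ball (2 * R)).image fun l => κ * L l
  have hn : ∀ x, ‖κ x‖ = ‖x‖ := fun x => by
    have h0 : κ 0 = 0 := by simpa using h.map_sub 0 0
    simpa [h0] using κ.dist_eq x 0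
  refine Set.Finite.of_finite_image ((hf.union hf').subset ?_) Subtype.val_injective.injOn
  rintro _ ⟨⟨γ, hγ⟩, ⟨_, ⟨x, hx, rfl⟩, hx'⟩, rfl⟩
  have h1 := hR x (Or.inl hx)
  rcases h.mem_group_iff.1 hγ with ⟨l, hl, rfl⟩ | ⟨l, hl, rfl⟩
  · have h2 : ‖x + l‖ ≤ R := hR _ (Or.inr hx')
    refine Or.inl ⟨l, ⟨hl, ?_⟩, rfl⟩
    have h3 := norm_sub_le (x + l) x
    rw [add_sub_cancel_left] at h3
    linarith
  · have h2 : ‖κ (x + l)‖ ≤ R := hR _ (Or.inr hx')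
    rw [hn] at h2
    refine Or.inr ⟨l, ⟨hl, ?_⟩, rfl⟩
    have h3 := norm_sub_le (x + l) x
    rw [add_sub_cancel_left] at h3
    linarith

/-- A nontrivial translation has no fixed point, and κ(x + l) = x forces l = κx - x. So a stabilizer
has at most one nontrivial element. -/
theorem eq_one_or_eq_of_apply_eq (h : IsHalfTurn κ) {x : E3} {γ : E3 ≃ᵢ E3}
    (hγ : γ ∈ halfTurnGroup κ) (hx : γ x = x) :
    γ = 1 ∨ κ x - x ∈ lattice ∧ γ = κ * L (κ x - x) := by
  rcases h.mem_group_iff.1 hγ with ⟨l, hl, rfl⟩ | ⟨l, hl, rfl⟩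
  · left
    have h1 : l = 0 := by simpa using (show x + l = x from hx)
    ext1 y
    change y + l = y
    rw [h1, add_zero]
  · right
    have h1 : κ (x + l) = x := hx
    have h2 : x + l = κ x := by rw [← h.apply_apply (x + l), h1]
    have h3 : l = κ x - x := by rw [← h2, add_sub_cancel_left]
    rw [← h3]
    exact ⟨hl, rfl⟩

theorem isotropy_ne_bot_iff (h : IsHalfTurn κ) (x : E3) :
    isotropy (halfTurnGroup κ) x ≠ ⊥ ↔ κ x - x ∈ lattice := by
  rw [Subgroup.ne_bot_iff_exists_ne_one]
  constructor
  · rintro ⟨⟨⟨γ, hγ⟩, hx⟩, hne⟩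
    have hx' : γ x = x := hx
    rcases h.eq_one_or_eq_of_apply_eq hγ hx' with h1 | h1
    · exact absurd (Subtype.ext (Subtype.ext h1)) hne
    · exact h1.1
  · intro hx
    have hm : κ * L (κ x - x) ∈ halfTurnGroup κ := h.mem_group_iff.2 (Or.inr ⟨_, hx, rfl⟩)
    refine ⟨⟨⟨_, hm⟩, ?_⟩, fun h1 => ?_⟩
    · change κ (x + (κ x - x)) = x
      rw [add_sub_cancel, h.apply_apply]
    · have h2 : κ * L (κ x - x) = 1 := congrArg (fun g => g.1.1) h1
      refine h.ne_one (IsometryEquiv.ext fun z => ?_)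
      have h3 : ∀ z, κ (z + (κ x - x)) = z := fun z => congrArg (fun γ : E3 ≃ᵢ E3 => γ z) h2
      have h4 := h3 0
      have h5 := h3 z
      rw [h.map_add] at h4 h5
      have h0 : κ 0 = 0 := by simpa using h.map_sub 0 0
      rw [h0, zero_add] at h4
      rwa [h4, add_zero] at h5

theorem isotropy_mulEquiv (h : IsHalfTurn κ) (x : E3) (hx : isotropy (halfTurnGroup κ) x ≠ ⊥) :
    Nonempty (isotropy (halfTurnGroup κ) x ≃* Multiplicative (ZMod 2)) := by
  obtain ⟨g, hg⟩ := Subgroup.ne_bot_iff_exists_ne_one.1 hx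
  have key : ∀ g : isotropy (halfTurnGroup κ) x, g ≠ 1 → g.1.1 = κ * L (κ x - x) := fun g hg =>
    ((h.eq_one_or_eq_of_apply_eq g.1.2 g.2).resolve_left fun h1 =>
      hg (Subtype.ext (Subtype.ext h1))).2
  have hc : Nat.card (isotropy (halfTurnGroup κ) x) = 2 := by
    refine Nat.card_eq_two_iff.2 ⟨1, g, hg.symm, Set.eq_univ_of_forall fun g' => ?_⟩
    by_cases h1 : g' = 1
    · exact Or.inl h1
    · exact Or.inr (Subtype.ext (Subtype.ext ((key g' h1).trans (key g hg).symm)))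
  have : Fact (Nat.Prime 2) := ⟨Nat.prime_two⟩
  exact ⟨mulEquivOfPrimeCardEq hc (by simp)⟩

theorem proj_eq_proj_iff (h : IsHalfTurn κ) {x y : E3} :
    proj (halfTurnGroup κ) x = proj (halfTurnGroup κ) y ↔ x - y ∈ lattice ∨ κ x - y ∈ lattice := by
  rw [FlatOrbifold.proj_eq_proj_iff]
  constructor
  · rintro ⟨γ, hγ, rfl⟩
    rcases h.mem_group_iff.1 hγ with ⟨l, hl, rfl⟩ | ⟨l, hl, rfl⟩
    · left
      change y + l - y ∈ lattice
      rwa [add_sub_cancel_left]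
    · right
      change κ (κ (y + l)) - y ∈ lattice
      rwa [h.apply_apply, add_sub_cancel_left]
  · rintro (h1 | h1)
    · exact ⟨L (x - y), h.mem_group_iff.2 (Or.inl ⟨_, h1, rfl⟩), add_sub_cancel y x⟩
    · refine ⟨κ * L (κ x - y), h.mem_group_iff.2 (Or.inr ⟨_, h1, rfl⟩), ?_⟩
      change κ (y + (κ x - y)) = x
      rw [add_sub_cancel, h.apply_apply]

theorem t2Space (h : IsHalfTurn κ) : T2Space (OrbitSpace (halfTurnGroup κ)) := by
  have := h.properlyDiscontinuousSMul
  exact t2Space_of_properlyDiscontinuousSMul_of_t2Space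

end IsHalfTurn

end HalfTurn

/-! ### The groups G₁, G₂ and their almost conjugacy -/

section DescendedGroups

variable {κ : E3 ≃ᵢ E3}

namespace IsHalfTurn

theorem pow_mul_L_mem (h : IsHalfTurn κ) (p : Fin 2 × Fin 2 × Fin 2) :
    κ ^ (p.1 : ℕ) * L (latticeRep p.2) ∈ halfTurnGroup κ :=
  h.mem_iff_exists_pow.2 ⟨p.1, _, latticeRep_mem p.2, rfl⟩

theorem le_latticeNormalizer (h : IsHalfTurn κ) :
    halfTurnGroup κ ≤ latticeNormalizer lattice' := by
  refine sup_le (translations_le_latticeNormalizer _) ?_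
  rw [Subgroup.closure_le]
  intro γ hγ
  rw [Set.mem_singleton_iff.1 hγ]
  exact signedPerm_le_latticeNormalizer_lattice' h.mem_signedPerm

/-- The element of the group of isometries of the torus with the given representative. -/
noncomputable def descendElement (h : IsHalfTurn κ) (p : Fin 2 × Fin 2 × Fin 2) :
    descend lattice' (halfTurnGroup κ) :=
  ⟨induced ⟨_, h.le_latticeNormalizer (h.pow_mul_L_mem p)⟩, _, h.pow_mul_L_mem p,
    isInducedBy_induced _⟩

theorem isInducedBy_descendElement (h : IsHalfTurn κ) (p : Fin 2 × Fin 2 × Fin 2) :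
    IsInducedBy lattice' (h.descendElement p).1 (κ ^ (p.1 : ℕ) * L (latticeRep p.2)) :=
  isInducedBy_induced _

theorem map_mem_lattice'_iff (h : IsHalfTurn κ) (x : E3) : x ∈ lattice' ↔ κ x ∈ lattice' :=
  signedPerm_mem_iff (a := 1) (fun y => by simp [frame_mem_lattice']) h.mem_signedPerm x

theorem pow_apply_sub (h : IsHalfTurn κ) (j : Fin 2) (x y : E3) :
    (κ ^ (j : ℕ)) x - (κ ^ (j : ℕ)) y = (κ ^ (j : ℕ)) (x - y) := by
  fin_cases j
  · rfl
  · simp [h.map_sub]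

theorem pow_mem_lattice'_iff (h : IsHalfTurn κ) (j : Fin 2) (x : E3) :
    x ∈ lattice' ↔ (κ ^ (j : ℕ)) x ∈ lattice' := by
  fin_cases j
  · rfl
  · simpa using h.map_mem_lattice'_iff x

theorem descendElement_bijective (h : IsHalfTurn κ) : Function.Bijective h.descendElement := by
  constructor
  · rintro ⟨i, p⟩ ⟨j, q⟩ hpq
    have h1 := h.isInducedBy_descendElement (i, p)
    rw [hpq] at h1
    obtain ⟨l, hl, e⟩ := (h.isInducedBy_descendElement (j, q)).exists_eq_translation_mul
      lattice'_separated h1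
    have e1 : ∀ x, (κ ^ (i : ℕ)) (x + latticeRep p) = (κ ^ (j : ℕ)) (x + latticeRep q) + l :=
      fun x => congrArg (fun γ : E3 ≃ᵢ E3 => γ x) e
    -- Equal induced isometries have lifts with equal linear parts, and κ ≠ 1 separates the two
    -- powers.
    have hij : i = j := by
      have e2 : ∀ x, (κ ^ (i : ℕ)) x = (κ ^ (j : ℕ)) x := fun x => by
        have h2 := h.pow_apply_sub i (x + latticeRep p) (0 + latticeRep p)
        have h3 := h.pow_apply_sub j (x + latticeRep q) (0 + latticeRep q)
        rw [e1, e1, add_sub_add_right_eq_sub, h3] at h2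
        simpa using h2.symm
      by_contra hne
      refine h.ne_one (IsometryEquiv.ext fun x => ?_)
      have h2 := e2 x
      fin_cases i <;> fin_cases j <;> simp at hne h2
      · exact h2.symm
      · exact h2
    subst hij
    have h4 := e1 0
    rw [← sub_eq_iff_eq_add', h.pow_apply_sub, add_sub_add_left_eq_sub] at h4
    rw [← h4, ← h.pow_mem_lattice'_iff] at hl
    rw [latticeRep_injective hl]
  · rintro ⟨f, γ, hγ, hf⟩
    obtain ⟨j, l, hl, rfl⟩ := h.mem_iff_exists_pow.1 hγ
    obtain ⟨p, hp⟩ := exists_sub_latticeRep_mem hl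
    refine ⟨(j, p), Subtype.ext ((h.isInducedBy_descendElement (j, p)).of_sub_mem
      (fun x => ?_) |>.eq hf)⟩
    change (κ ^ (j : ℕ)) (x + l) - (κ ^ (j : ℕ)) (x + latticeRep p) ∈ _
    rwa [h.pow_apply_sub, add_sub_add_left_eq_sub, ← h.pow_mem_lattice'_iff]

theorem card_descend (h : IsHalfTurn κ) : Nat.card (descend lattice' (halfTurnGroup κ)) = 8 := by
  rw [← Nat.card_eq_of_bijective _ h.descendElement_bijective]
  simp

end IsHalfTurn

theorem τ_mem_H : τ ∈ H := Subgroup.subset_closure (by simp)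
theorem ρ_mem_H : ρ ∈ H := Subgroup.subset_closure (by simp)
theorem A_mem_H : A ∈ H := Subgroup.subset_closure (by simp)

theorem G₁_le_G : G₁ ≤ G := descend_mono (IsHalfTurn.le_ambient τ_mem_H)
theorem G₂_le_G : G₂ ≤ G := descend_mono (IsHalfTurn.le_ambient ρ_mem_H)

/-- The permutation of representatives matching conjugate elements. -/
def swapRep : Fin 2 × Fin 2 × Fin 2 → Fin 2 × Fin 2 × Fin 2
  | (0, p) => (0, p)
  | (1, p) => (1, p.swap)

theorem swapRep_involutive : Function.Involutive swapRep := by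
  rintro ⟨j, p⟩
  fin_cases j <;> rfl

/-- The bijection between `G₁` and `G₂` matching conjugate elements. -/
noncomputable def conjEquiv : G₁ ≃ G₂ :=
  ((Equiv.ofBijective _ isHalfTurn_τ.descendElement_bijective).symm.trans
    swapRep_involutive.toPerm).trans (Equiv.ofBijective _ isHalfTurn_ρ.descendElement_bijective)

theorem conjEquiv_descendElement (p : Fin 2 × Fin 2 × Fin 2) :
    conjEquiv (isHalfTurn_τ.descendElement p) = isHalfTurn_ρ.descendElement (swapRep p) := by
  have : (Equiv.ofBijective _ isHalfTurn_τ.descendElement_bijective).symm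
      (isHalfTurn_τ.descendElement p) = p :=
    Equiv.ofBijective_symm_apply_apply _ isHalfTurn_τ.descendElement_bijective p
  exact congrArg (fun q => isHalfTurn_ρ.descendElement (swapRep q)) this

/-- `A` followed by a translation conjugates `τ L_b` into `ρ L_{b'}` modulo `lattice'`. -/
theorem conj_sub_mem (p : Fin 2 × Fin 2) (x : E3) :
    A (τ (x + latticeRep p)) + frame ![0, (((p.1 : ℕ) : ℝ) + ((p.2 : ℕ) : ℝ)) / 4, 0] -
      ρ (A x + frame ![0, (((p.1 : ℕ) : ℝ) + ((p.2 : ℕ) : ℝ)) / 4, 0] + latticeRep p.swap) ∈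
        lattice' := by
  obtain ⟨y, rfl⟩ := frame.surjective x
  simp only [latticeRep, ← map_add, τ_frame, A_frame, ρ_frame, ← map_sub, frame_mem_lattice']
  intro i
  fin_cases i
  · exact ⟨0, by simp⟩
  · exact ⟨(p.1 : ℕ) + (p.2 : ℕ), by simp; ring⟩
  · exact ⟨0, by simp⟩

/-- The conjugator is A followed by a quarter-lattice translation along the middle frame vector. ρ
reverses that direction, so the translation counts twice and corrects the offset (m+k)/2 modulo Λ'.
-/
theorem isConj_of_isInducedBy {p : Fin 2 × Fin 2} {f g : G}
    (hf : IsInducedBy lattice' f.1 (τ * L (latticeRep p)))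
    (hg : IsInducedBy lattice' g.1 (ρ * L (latticeRep p.swap))) : IsConj f g := by
  have hC : L (frame ![0, (((p.1 : ℕ) : ℝ) + ((p.2 : ℕ) : ℝ)) / 4, 0]) * A ∈
      H ⊔ translations quarterLattice' := by
    refine mul_mem (Subgroup.mem_sup_right ⟨_, ?_, rfl⟩) (Subgroup.mem_sup_left A_mem_H)
    rw [frame_mem_quarterLattice']
    intro i
    fin_cases i
    · exact ⟨0, by simp⟩
    · exact ⟨(p.1 : ℕ) + (p.2 : ℕ), by simp; ring⟩
    · exact ⟨0, by simp⟩
  obtain ⟨c, hc⟩ := exists_isInducedBy (ambient_le_latticeNormalizer hC)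
  have e : c * f.1 = g.1 * c :=
    ((hg.mul hc).of_sub_mem fun x => conj_sub_mem p x).eq (hc.mul hf) |>.symm
  refine isConj_iff.2 ⟨⟨c, _, hC, hc⟩, ?_⟩
  rw [mul_inv_eq_iff_eq_mul]
  exact Subtype.ext e

theorem isConj_descendElement (p : Fin 2 × Fin 2 × Fin 2) {f g : G}
    (hf : IsInducedBy lattice' f.1 (τ ^ (p.1 : ℕ) * L (latticeRep p.2)))
    (hg : IsInducedBy lattice' g.1
      (ρ ^ ((swapRep p).1 : ℕ) * L (latticeRep (swapRep p).2))) : IsConj f g := by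
  obtain ⟨j, p⟩ := p
  obtain rfl | rfl : j = 0 ∨ j = 1 := by fin_cases j <;> simp
  · simp only [swapRep, Fin.val_zero, pow_zero] at hf hg
    rw [show f = g from Subtype.ext (hf.eq hg)]
  · simp only [swapRep, Fin.val_one, pow_one] at hf hg
    exact isConj_of_isInducedBy hf hg

theorem isConj_conjEquiv (f : G₁) :
    IsConj (⟨f.1, G₁_le_G f.2⟩ : G) ⟨(conjEquiv f).1, G₂_le_G (conjEquiv f).2⟩ := by
  obtain ⟨p, rfl⟩ := isHalfTurn_τ.descendElement_bijective.2 f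
  have e := conjEquiv_descendElement p
  generalize conjEquiv (isHalfTurn_τ.descendElement p) = g at e
  subst e
  exact isConj_descendElement p (isHalfTurn_τ.isInducedBy_descendElement p)
    (isHalfTurn_ρ.isInducedBy_descendElement (swapRep p))

/-- `conjEquiv` as a bijection between subgroups of `G`. -/
noncomputable def conjEquivSubgroupOf : G₁.subgroupOf G ≃ G₂.subgroupOf G :=
  ((Subgroup.subgroupOfEquivOfLe G₁_le_G).toEquiv.trans conjEquiv).trans
    (Subgroup.subgroupOfEquivOfLe G₂_le_G).toEquiv.symm

theorem isConj_conjEquivSubgroupOf (f : G₁.subgroupOf G) :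
    IsConj (f : G) (conjEquivSubgroupOf f) :=
  isConj_conjEquiv (Subgroup.subgroupOfEquivOfLe G₁_le_G f)

theorem finite_G₁_subgroupOf : Finite (G₁.subgroupOf G) :=
  have := finite_G
  inferInstance

theorem almostConjugate_G₁_G₂ : AlmostConjugate (G₁.subgroupOf G) (G₂.subgroupOf G) :=
  have := finite_G₁_subgroupOf
  almostConjugate_of_equiv conjEquivSubgroupOf isConj_conjEquivSubgroupOf

theorem isospectralOnForms_Γ₁_Γ₂ (k : ℕ) : IsospectralOnForms Γ₁ Γ₂ k :=
  have : Finite ((descend lattice' (halfTurnGroup τ)).subgroupOf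
    (descend lattice' (H ⊔ translations quarterLattice'))) := finite_G₁_subgroupOf
  isospectralOnForms_of_equiv lattice'_separated finiteDimensional_eigenforms_translations
    IsHalfTurn.translations_le IsHalfTurn.translations_le (IsHalfTurn.le_ambient τ_mem_H)
    (IsHalfTurn.le_ambient ρ_mem_H) ambient_le_latticeNormalizer conjEquivSubgroupOf
    isConj_conjEquivSubgroupOf k

end DescendedGroups

/-! ### Fixed lines and the circles they cover -/

section SingularSets

theorem mem_lattice {x : E3} : x ∈ lattice ↔ (∃ a : ℤ, (x 0 : ℝ) = a) ∧ (∃ b : ℤ, (x 1 : ℝ) = b) ∧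
    ∃ c : ℤ, (x 2 : ℝ) = c / √2 := Iff.rfl

theorem τ_apply (x : E3) : τ x = !₂[-x 1, -x 0, -x 2] := by
  change WithLp.toLp 2 (_ *ᵥ _) = _
  ext i
  fin_cases i <;> simp [Matrix.mulVec, dotProduct, Fin.sum_univ_three]

theorem ρ_apply (x : E3) : ρ x = !₂[-x 0, -x 1, x 2] := by
  change WithLp.toLp 2 (_ *ᵥ _) = _
  ext i
  fin_cases i <;> simp [Matrix.mulVec, dotProduct, Fin.sum_univ_three]

theorem div_two_mul_sqrt_two (m : ℝ) : m / (2 * √2) = m / 2 / √2 := by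
  rw [div_div]

theorem τ_sub_mem_iff {x : E3} : τ x - x ∈ lattice ↔
    (∃ m : ℤ, (x 2 : ℝ) = m / (2 * √2)) ∧ ∃ m : ℤ, (x 0 + x 1 : ℝ) = m := by
  have h0 : (√2 : ℝ) ≠ 0 := by positivity
  rw [mem_lattice, τ_apply]
  simp only [PiLp.sub_apply, Matrix.cons_val_zero, Matrix.cons_val_one, Matrix.cons_val]
  constructor
  · rintro ⟨⟨a, ha⟩, -, ⟨c, hc⟩⟩
    refine ⟨⟨-c, ?_⟩, ⟨-a, ?_⟩⟩
    · rw [div_two_mul_sqrt_two]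
      push_cast
      linear_combination (-1 / 2 : ℝ) * hc
    · push_cast
      linarith
  · rintro ⟨⟨c, hc⟩, ⟨a, ha⟩⟩
    refine ⟨⟨-a, by push_cast; linarith⟩, ⟨-a, by push_cast; linarith⟩, ⟨-c, ?_⟩⟩
    rw [div_two_mul_sqrt_two] at hc
    push_cast
    linear_combination (-2 : ℝ) * hc

theorem ρ_sub_mem_iff {x : E3} : ρ x - x ∈ lattice ↔
    (∃ m : ℤ, (x 0 : ℝ) = m / 2) ∧ ∃ m : ℤ, (x 1 : ℝ) = m / 2 := by
  rw [mem_lattice, ρ_apply]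
  simp only [PiLp.sub_apply, Matrix.cons_val_zero, Matrix.cons_val_one, Matrix.cons_val]
  constructor
  · rintro ⟨⟨a, ha⟩, ⟨b, hb⟩, -⟩
    exact ⟨⟨-a, by push_cast; linarith⟩, ⟨-b, by push_cast; linarith⟩⟩
  · rintro ⟨⟨a, ha⟩, ⟨b, hb⟩⟩
    exact ⟨⟨-a, by push_cast; linarith⟩, ⟨-b, by push_cast; linarith⟩, ⟨0, by simp⟩⟩

variable {κ : E3 ≃ᵢ E3}

theorem IsHalfTurn.mem_singularSet_iff (h : IsHalfTurn κ) {p : OrbitSpace (halfTurnGroup κ)} :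
    p ∈ singularSet (halfTurnGroup κ) ↔ ∃ x, proj (halfTurnGroup κ) x = p ∧ κ x - x ∈ lattice := by
  simp only [singularSet, Set.mem_ofPred_eq, h.isotropy_ne_bot_iff]

/-- Zero is the multiple of w nearest to d. -/
theorem abs_le_abs_sub_int_mul {d w : ℝ} (h : |d| < w / 2) (a : ℤ) : |d| ≤ |d - a * w| := by
  rcases eq_or_ne a 0 with rfl | ha
  · simp
  · have h1 : (1 : ℝ) ≤ |(a : ℝ)| := by exact_mod_cast Int.one_le_abs ha
    have hw : 0 < w := by linarith [abs_nonneg d]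
    have h2 : w ≤ |a * w| := by
      rw [abs_mul, abs_of_pos hw]
      nlinarith
    have h3 := abs_sub_abs_le_abs_sub (a * w) d
    rw [abs_sub_comm] at h3
    linarith

/-- The distance between nearby points on a singular line is not shortened by the group. -/
theorem IsHalfTurn.abs_sub_le_dist (h : IsHalfTurn κ) {u : E3 → ℝ} {w : ℝ}
    (hu : ∀ x y, |u x - u y| ≤ dist x y) (hadd : ∀ x y, u (x + y) = u x + u y)
    (hκ : ∀ x, u (κ x) = u x) (hl : ∀ l ∈ lattice, ∃ a : ℤ, u l = a * w) (x y : E3)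
    {γ : E3 ≃ᵢ E3} (hγ : γ ∈ halfTurnGroup κ) (hxy : |u x - u y| < w / 2) :
    |u x - u y| ≤ dist x (γ y) := by
  -- The coordinate u along the axis changes under the group only by multiples of w, and u is
  -- 1-Lipschitz.
  have key : ∃ a : ℤ, u (γ y) = u y + a * w := by
    rcases h.mem_group_iff.1 hγ with ⟨l, hm, rfl⟩ | ⟨l, hm, rfl⟩
    · obtain ⟨a, ha⟩ := hl l hm
      exact ⟨a, by rw [← ha, ← hadd]; rfl⟩
    · obtain ⟨a, ha⟩ := hl l hm
      exact ⟨a, by rw [← ha, ← hadd]; exact hκ _⟩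
  obtain ⟨a, ha⟩ := key
  refine le_trans ?_ (hu x (γ y))
  rw [ha, ← sub_sub]
  exact abs_le_abs_sub_int_mul hxy a

theorem coe_eq_coe_iff {ℓ s t : ℝ} : (s : AddCircle ℓ) = t ↔ ∃ a : ℤ, s - t = a * ℓ := by
  rw [← sub_eq_zero, ← AddCircle.coe_sub, AddCircle.coe_eq_zero_iff]
  simp [eq_comm]

theorem dist_sq_eq (x y : E3) :
    dist x y ^ 2 = (x 0 - y 0) ^ 2 + (x 1 - y 1) ^ 2 + (x 2 - y 2) ^ 2 := by
  rw [EuclideanSpace.dist_eq, Real.sq_sqrt (Finset.sum_nonneg fun _ _ => sq_nonneg _)]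
  simp [Fin.sum_univ_three, Real.dist_eq, sq_abs]

/-- The lines of fixed points of elements of `Γ₁`. -/
noncomputable def singularLine₁ (i : Fin 2) (s : ℝ) : E3 :=
  !₂[s / √2, -(s / √2), ((i : ℕ) : ℝ) / 2 / √2]

/-- The lines of fixed points of elements of `Γ₂`. -/
noncomputable def singularLine₂ (i : Fin 4) (s : ℝ) : E3 :=
  !₂[(((i : ℕ) / 2 : ℕ) : ℝ) / 2, (((i : ℕ) % 2 : ℕ) : ℝ) / 2, s]

theorem natCast_real_eq {p : ℕ} {a b : ℤ} (h : (p : ℤ) = a + 2 * b) : (p : ℝ) = a + 2 * b := by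
  exact_mod_cast h

theorem eq_of_half_sub_half {p q : ℕ} (hp : p < 2) (hq : q < 2) {c : ℤ}
    (h : (p : ℝ) / 2 - (q : ℝ) / 2 = c) : p = q := by
  have h1 : (p : ℝ) = 2 * c + q := by linarith
  have h2 : (p : ℤ) = 2 * c + q := by exact_mod_cast h1
  omega

theorem eq_of_neg_half_sub_half {p q : ℕ} (hp : p < 2) (hq : q < 2) {c : ℤ}
    (h : -((p : ℝ) / 2) - (q : ℝ) / 2 = c) : p = q := by
  have h1 : (p : ℝ) = -(2 * c) - q := by linarith
  have h2 : (p : ℤ) = -(2 * c) - q := by exact_mod_cast h1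
  omega

theorem fin_four_eq {i j : Fin 4} (h : (i : ℕ) / 2 = (j : ℕ) / 2) (h' : (i : ℕ) % 2 = (j : ℕ) % 2) :
    i = j := by
  omega

theorem singularSet_halfTurnGroup_τ :
    IsDisjointUnionOfCircles (halfTurnGroup τ) (singularSet (halfTurnGroup τ)) 2 (√2) := by
  have hs : (√2 : ℝ) * √2 = 2 := Real.mul_self_sqrt (by norm_num)
  have h0 : (√2 : ℝ) ≠ 0 := by positivity
  have hp : (0 : ℝ) < √2 := by positivity
  have := isHalfTurn_τ.t2Space
  -- Arc length along the axis of τ. On Λ it takes the values (a - b)/√2, so w = 1/√2 below,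
  -- although the circle has length √2: the shortest translations of Λ along the axis are ±(1,-1,0).
  let u : E3 → ℝ := fun x => (x 0 - x 1) / √2
  have hu : ∀ i s, u (singularLine₁ i s) = s := fun i s => by
    simp only [u, singularLine₁, Matrix.cons_val_zero, Matrix.cons_val_one]
    field_simp
    linear_combination -s * hs
  have hu1 : ∀ x y, |u x - u y| ≤ dist x y := fun x y => by
    refine abs_le_of_sq_le_sq ?_ dist_nonneg
    rw [dist_sq_eq]
    have : (u x - u y) ^ 2 = ((x 0 - y 0) - (x 1 - y 1)) ^ 2 / 2 := by
      simp only [u]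
      rw [← sub_div, div_pow, Real.sq_sqrt (by norm_num)]
      ring
    rw [this]
    nlinarith [sq_nonneg ((x 0 - y 0) + (x 1 - y 1)), sq_nonneg (x 2 - y 2)]
  refine isDisjointUnionOfCircles_of_curves (c := singularLine₁)
    (ε := 1 / √2 / 2) hp (by positivity) ?_ ?_ ?_ ?_
  · intro i
    refine Isometry.of_dist_eq fun s t => ?_
    rw [← sq_eq_sq₀ dist_nonneg dist_nonneg, dist_sq_eq, Real.dist_eq, sq_abs]
    simp [singularLine₁]
    field_simp
    rw [Real.sq_sqrt (by norm_num)]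
    ring
  · intro p
    rw [isHalfTurn_τ.mem_singularSet_iff]
    constructor
    · rintro ⟨x, rfl, hx⟩
      obtain ⟨⟨c, hc⟩, ⟨a, ha⟩⟩ := τ_sub_mem_iff.1 hx
      -- The parameter makes the second coordinate agree with that of x; the first then differs by
      -- an integer, and the height by an even multiple of 1/(2√2).
      refine ⟨⟨(c % 2).toNat, by omega⟩, -√2 * x 1, ?_⟩
      rw [isHalfTurn_τ.proj_eq_proj_iff]
      left
      rw [mem_lattice]
      have h1 : c % 2 - c = 2 * (-(c / 2)) := by omega
      have h2 : (((c % 2).toNat : ℕ) : ℤ) = c % 2 := by omega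
      have h3 : (((c % 2).toNat : ℕ) : ℝ) = ((c % 2 : ℤ) : ℝ) := by exact_mod_cast h2
      have h4 : ((c % 2 : ℤ) : ℝ) - c = 2 * ((-(c / 2) : ℤ) : ℝ) := by exact_mod_cast h1
      refine ⟨⟨-a, ?_⟩, ⟨0, ?_⟩, ⟨-(c / 2), ?_⟩⟩
      · simp only [singularLine₁, PiLp.sub_apply, Matrix.cons_val_zero]
        field_simp
        push_cast
        linarith
      · simp only [singularLine₁, PiLp.sub_apply, Matrix.cons_val_one, Matrix.cons_val_zero]
        field_simp
        simp
      · simp only [singularLine₁, PiLp.sub_apply, Matrix.cons_val]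
        rw [hc, h3, div_two_mul_sqrt_two, ← sub_div, ← sub_div, h4]
        ring
    · rintro ⟨i, s, rfl⟩
      refine ⟨_, rfl, τ_sub_mem_iff.2 ⟨⟨(i : ℕ), ?_⟩, ⟨0, ?_⟩⟩⟩
      · simp [singularLine₁, div_two_mul_sqrt_two]
      · simp [singularLine₁]
  · intro i j s t
    rw [isHalfTurn_τ.proj_eq_proj_iff, coe_eq_coe_iff, mem_lattice, mem_lattice, τ_apply]
    simp only [singularLine₁, PiLp.sub_apply, Matrix.cons_val_zero, Matrix.cons_val_one,
      Matrix.cons_val, PiLp.toLp_apply]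
    constructor
    · rintro (⟨⟨a, ha⟩, -, ⟨c, hc⟩⟩ | ⟨⟨a, ha⟩, -, ⟨c, hc⟩⟩)
      · rw [← sub_div, div_left_inj' h0] at hc
        rw [← sub_div, div_eq_iff h0] at ha
        exact ⟨Fin.ext (eq_of_half_sub_half i.2 j.2 hc), a, ha⟩
      -- τ fixes the parameter s and negates the height i/(2√2), which is the same height modulo Λ;
      -- so no new identifications arise.
      · rw [← neg_div, ← sub_div, div_left_inj' h0] at hc
        rw [neg_neg, ← sub_div, div_eq_iff h0] at ha
        exact ⟨Fin.ext (eq_of_neg_half_sub_half i.2 j.2 hc), a, ha⟩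
    · rintro ⟨rfl, a, ha⟩
      have ha' : s / √2 - t / √2 = a := by rw [← sub_div, ha, mul_div_cancel_right₀ _ h0]
      refine Or.inl ⟨⟨a, ha'⟩, ⟨-a, ?_⟩, ⟨0, by simp⟩⟩
      push_cast
      linarith
  · intro i s t γ hγ hst
    have h1 := isHalfTurn_τ.abs_sub_le_dist (w := 1 / √2) hu1
      (fun x y => by simp only [u, PiLp.add_apply]; ring)
      (fun x => by simp only [u, τ_apply, Matrix.cons_val_zero, Matrix.cons_val_one]; ring)
      (fun l hl => by
        obtain ⟨⟨a, ha⟩, ⟨b, hb⟩, -⟩ := mem_lattice.1 hl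
        exact ⟨a - b, by simp only [u, ha, hb]; push_cast; ring⟩)
      (singularLine₁ i s) (singularLine₁ i t) hγ
    simp only [hu] at h1
    exact h1 hst

theorem singularSet_halfTurnGroup_ρ :
    IsDisjointUnionOfCircles (halfTurnGroup ρ) (singularSet (halfTurnGroup ρ)) 4 (1 / √2) := by
  have := isHalfTurn_ρ.t2Space
  refine isDisjointUnionOfCircles_of_curves (c := singularLine₂)
    (ε := 1 / √2 / 2) (by positivity) (by positivity) ?_ ?_ ?_ ?_
  · intro i
    refine Isometry.of_dist_eq fun s t => ?_
    rw [← sq_eq_sq₀ dist_nonneg dist_nonneg, dist_sq_eq, Real.dist_eq, sq_abs]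
    simp [singularLine₂]
  · intro p
    rw [isHalfTurn_ρ.mem_singularSet_iff]
    constructor
    · rintro ⟨x, rfl, hx⟩
      obtain ⟨⟨a, ha⟩, ⟨b, hb⟩⟩ := ρ_sub_mem_iff.1 hx
      -- The four axes are indexed by the parities of 2x₀ and 2x₁, read as the two binary digits of
      -- i.
      refine ⟨⟨2 * (a % 2).toNat + (b % 2).toNat, by omega⟩, x 2, ?_⟩
      rw [isHalfTurn_ρ.proj_eq_proj_iff]
      left
      rw [mem_lattice]
      have h1 : (((2 * (a % 2).toNat + (b % 2).toNat) / 2 : ℕ) : ℤ) = a + 2 * (-(a / 2)) := by omega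
      have h2 : (((2 * (a % 2).toNat + (b % 2).toNat) % 2 : ℕ) : ℤ) = b + 2 * (-(b / 2)) := by omega
      have h3 : (((2 * (a % 2).toNat + (b % 2).toNat) / 2 : ℕ) : ℝ) =
          a + 2 * ((-(a / 2) : ℤ) : ℝ) := natCast_real_eq h1
      have h4 : (((2 * (a % 2).toNat + (b % 2).toNat) % 2 : ℕ) : ℝ) =
          b + 2 * ((-(b / 2) : ℤ) : ℝ) := natCast_real_eq h2
      refine ⟨⟨-(a / 2), ?_⟩, ⟨-(b / 2), ?_⟩, ⟨0, ?_⟩⟩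
      · simp only [singularLine₂, PiLp.sub_apply, Matrix.cons_val_zero]
        linarith
      · simp only [singularLine₂, PiLp.sub_apply, Matrix.cons_val_one, Matrix.cons_val_zero]
        linarith
      · simp [singularLine₂]
    · rintro ⟨i, s, rfl⟩
      exact ⟨_, rfl, ρ_sub_mem_iff.2 ⟨⟨(((i : ℕ) / 2 : ℕ) : ℤ), by rw [Int.cast_natCast]; rfl⟩,
        ⟨(((i : ℕ) % 2 : ℕ) : ℤ), by rw [Int.cast_natCast]; rfl⟩⟩⟩
  · intro i j s t
    rw [isHalfTurn_ρ.proj_eq_proj_iff, coe_eq_coe_iff, mem_lattice, mem_lattice, ρ_apply]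
    simp only [singularLine₂, PiLp.sub_apply, Matrix.cons_val_zero, Matrix.cons_val_one,
      Matrix.cons_val, PiLp.toLp_apply, mul_one_div]
    constructor
    · rintro (⟨⟨a, ha⟩, ⟨b, hb⟩, hc⟩ | ⟨⟨a, ha⟩, ⟨b, hb⟩, hc⟩)
      · exact ⟨fin_four_eq (eq_of_half_sub_half (by omega) (by omega) ha)
          (eq_of_half_sub_half (by omega) (by omega) hb), hc⟩
      · exact ⟨fin_four_eq (eq_of_neg_half_sub_half (by omega) (by omega) ha)
          (eq_of_neg_half_sub_half (by omega) (by omega) hb), hc⟩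
    · rintro ⟨rfl, hc⟩
      exact Or.inl ⟨⟨0, by simp⟩, ⟨0, by simp⟩, hc⟩
  · intro i s t γ hγ hst
    refine isHalfTurn_ρ.abs_sub_le_dist (u := fun x => x 2) (w := 1 / √2) (fun x y => ?_)
      (fun x y => rfl) (fun x => by simp [ρ_apply]) (fun l hl => ?_)
      (singularLine₂ i s) (singularLine₂ i t) hγ hst
    · refine abs_le_of_sq_le_sq ?_ dist_nonneg
      rw [dist_sq_eq]
      nlinarith [sq_nonneg (x 0 - y 0), sq_nonneg (x 1 - y 1)]
    · obtain ⟨-, -, ⟨c, hc⟩⟩ := mem_lattice.1 hl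
      exact ⟨c, by simp only [hc, mul_one_div]⟩

end SingularSets

end FlatOrbifold

theorem mainTheorem8 :
    -- the crystallographic groups: explicit form, proper discontinuity, compact quotients
    ((Γ₁ : Set (E3 ≃ᵢ E3)) = {γ | ∃ j : Fin 2, ∃ l ∈ lattice, γ = τ ^ (j : ℕ) * L l} ∧
      (Γ₂ : Set (E3 ≃ᵢ E3)) = {γ | ∃ j : Fin 2, ∃ l ∈ lattice, γ = ρ ^ (j : ℕ) * L l} ∧
      ProperlyDiscontinuousSMul Γ₁ E3 ∧ ProperlyDiscontinuousSMul Γ₂ E3 ∧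
      CompactSpace (OrbitSpace Γ₁) ∧ CompactSpace (OrbitSpace Γ₂)) ∧
    -- all nontrivial isotropy groups are cyclic of order two
    (∀ x : E3, isotropy Γ₁ x ≠ ⊥ → Nonempty (isotropy Γ₁ x ≃* Multiplicative (ZMod 2))) ∧
    (∀ x : E3, isotropy Γ₂ x ≠ ⊥ → Nonempty (isotropy Γ₂ x ≃* Multiplicative (ZMod 2))) ∧
    -- the points with nontrivial isotropy
    {x : E3 | isotropy Γ₁ x ≠ ⊥} =
      {x | (∃ m : ℤ, (x 2 : ℝ) = m / (2 * √2)) ∧ ∃ m : ℤ, (x 0 + x 1 : ℝ) = m} ∧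
    {x : E3 | isotropy Γ₂ x ≠ ⊥} =
      {x | (∃ m : ℤ, (x 0 : ℝ) = m / 2) ∧ ∃ m : ℤ, (x 1 : ℝ) = m / 2} ∧
    -- the singular sets
    IsDisjointUnionOfCircles Γ₁ (singularSet Γ₁) 2 (√2) ∧
    IsDisjointUnionOfCircles Γ₂ (singularSet Γ₂) 4 (1 / √2) ∧
    IsEmpty (singularSet Γ₁ ≃ₜ singularSet Γ₂) ∧
    -- Sunada isospectrality: quotients of a common compact torus by almost conjugate groups
    (lattice' ≤ lattice ∧ lattice'.relIndex lattice = 4 ∧ CompactSpace (Torus lattice')) ∧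
    ((G₁ : Set (Torus lattice' ≃ᵢ Torus lattice')) =
        {f | ∃ j : Fin 2, ∃ l ∈ lattice, IsInducedBy lattice' f (τ ^ (j : ℕ) * L l)} ∧
      (G₂ : Set (Torus lattice' ≃ᵢ Torus lattice')) =
        {f | ∃ j : Fin 2, ∃ l ∈ lattice, IsInducedBy lattice' f (ρ ^ (j : ℕ) * L l)} ∧
      (G : Set (Torus lattice' ≃ᵢ Torus lattice')) =
        {f | ∃ B ∈ H, ∃ b : E3, 4 • b ∈ lattice' ∧ IsInducedBy lattice' f (B * L b)}) ∧
    Nat.card G₁ = 8 ∧ Nat.card G₂ = 8 ∧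
    Finite G ∧ G₁ ≤ G ∧ G₂ ≤ G ∧
    AlmostConjugate (G₁.subgroupOf G) (G₂.subgroupOf G) ∧
    OrbifoldIsometric Γ₁ G₁ ∧ OrbifoldIsometric Γ₂ G₂ ∧
    -- isospectrality on `k`-forms for all `k`
    (∀ k : ℕ, IsospectralOnForms Γ₁ Γ₂ k) := by
  refine ⟨⟨isHalfTurn_τ.coe_group_eq, isHalfTurn_ρ.coe_group_eq,
      isHalfTurn_τ.properlyDiscontinuousSMul, isHalfTurn_ρ.properlyDiscontinuousSMul,
      compactSpace_orbitSpace IsHalfTurn.translations_le,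
      compactSpace_orbitSpace IsHalfTurn.translations_le⟩,
    isHalfTurn_τ.isotropy_mulEquiv, isHalfTurn_ρ.isotropy_mulEquiv,
    Set.ext fun x => (isHalfTurn_τ.isotropy_ne_bot_iff x).trans τ_sub_mem_iff,
    Set.ext fun x => (isHalfTurn_ρ.isotropy_ne_bot_iff x).trans ρ_sub_mem_iff,
    singularSet_halfTurnGroup_τ, singularSet_halfTurnGroup_ρ, ⟨fun e => ?_⟩,
    ⟨lattice'_le_lattice, relIndex_lattice', compactSpace_torus⟩,
    ⟨isHalfTurn_τ.coe_descend_eq, isHalfTurn_ρ.coe_descend_eq, G_eq⟩,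
    isHalfTurn_τ.card_descend, isHalfTurn_ρ.card_descend, finite_G, G₁_le_G, G₂_le_G,
    almostConjugate_G₁_G₂,
    orbifoldIsometric_descend lattice'_separated IsHalfTurn.translations_le
      isHalfTurn_τ.le_latticeNormalizer,
    orbifoldIsometric_descend lattice'_separated IsHalfTurn.translations_le
      isHalfTurn_ρ.le_latticeNormalizer,
    isospectralOnForms_Γ₁_Γ₂⟩
  have := singularSet_halfTurnGroup_τ.le_of_homeomorph singularSet_halfTurnGroup_ρ e
  omega
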